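/- All rings are associative with identity and modules are unitary left modules unless said otherwise. Let $A$ and $B$ be rings, let $U$ be a $(B,A)$-bimodule, and let $$T=\begin{pmatrix} A & 0\\ U & B\end{pmatrix}$$ be the formal triangular matrix ring, with the usual matrix addition and multiplication. For a ring $R$ and an $R$-module $C$, $\mathrm{Add}_R(C)$ is the class of all $R$-modules isomorphic to a direct summand of a direct sum of copies of $C$; in particular $\mathrm{Add}_R(R)$ is the class of projective $R$-modules. The bimodule $U$ is called *compatible* if (a) the complex $U\otimes_A \mathbf{X}_1$ is exact for every exact sequence of $A$-modules $$\mathbf{X}_1:\ \cdots\to P_1^1\to P_1^0\to C_1^0\to C_1^1\to\cdots$$ with all $P_1^i$ projective and all $C_1^i\in\mathrm{Add}_A(A)$; and (b) the complex $\mathrm{Hom}_B(\mathbf{X}_2,U\otimes_A Q)$ is exact for every $Q\in \mathrm{Add}_A(A)$ and every exact sequence of $B$-modules $$\mathbf{X}_2:\ \cdots\to P_2^1\to P_2^0\to C_2^0\to C_2^1\to\cdots$$ with all $P_2^i$ projective and all $C_2^i\in\mathrm{Add}_B(B)$, such that $\mathrm{Hom}_B(\mathbf{X}_2,Y)$ is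 exact for every $Y\in\mathrm{Add}_B(B)$. A ring $R$ is called *left Gorenstein regular* if the category of left $R$-modules is a Gorenstein category, that is: a module has finite projective dimension if and only if it has finite injective dimension; there is a common finite bound for the projective dimensions of the modules of finite projective dimension, and likewise for the injective dimensions of the modules of finite injective dimension; and there is a generator of finite projective dimension. **Corollary.** If $U$ is compatible, then $T$ is left Gorenstein regular if and only if both $A$ and $B$ are left Gorenstein regular. (No finiteness of the projective dimension of $_BU$ or of the flat dimension of $U_A$ is assumed.) -/

import Mathlib

open CategoryTheory
open scoped TensorProduct

universe u

/-! ### The formal triangular matrix ring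

Throughout, a `(B, A)`-bimodule is a left `B`-module `U` which is also a right `A`-module
(a module over `Aᵐᵒᵖ`), such that the two actions commute. -/

/-- Matrices `(a 0; u b)` with `a ∈ A`, `u ∈ U`, `b ∈ B`. -/
@[ext]
structure TriangularRing (A B U : Type u) : Type u where
  a : A
  u : U
  b : B

namespace TriangularRing

section

variable {A B U : Type u} [Ring A] [Ring B] [AddCommGroup U]

instance : Zero (TriangularRing A B U) := ⟨⟨0, 0, 0⟩⟩
instance : One (TriangularRing A B U) := ⟨⟨1, 0, 1⟩⟩
instance : Add (TriangularRing A B U) := ⟨fun x y => ⟨x.a + y.a, x.u + y.u, x.b + y.b⟩⟩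
instance : Neg (TriangularRing A B U) := ⟨fun x => ⟨-x.a, -x.u, -x.b⟩⟩

@[simp] theorem zero_a : (0 : TriangularRing A B U).a = 0 := rfl
@[simp] theorem zero_u : (0 : TriangularRing A B U).u = 0 := rfl
@[simp] theorem zero_b : (0 : TriangularRing A B U).b = 0 := rfl
@[simp] theorem one_a : (1 : TriangularRing A B U).a = 1 := rfl
@[simp] theorem one_u : (1 : TriangularRing A B U).u = 0 := rfl
@[simp] theorem one_b : (1 : TriangularRing A B U).b = 1 := rfl
@[simp] theorem add_a (x y : TriangularRing A B U) : (x + y).a = x.a + y.a := rfl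
@[simp] theorem add_u (x y : TriangularRing A B U) : (x + y).u = x.u + y.u := rfl
@[simp] theorem add_b (x y : TriangularRing A B U) : (x + y).b = x.b + y.b := rfl
@[simp] theorem neg_a (x : TriangularRing A B U) : (-x).a = -x.a := rfl
@[simp] theorem neg_u (x : TriangularRing A B U) : (-x).u = -x.u := rfl
@[simp] theorem neg_b (x : TriangularRing A B U) : (-x).b = -x.b := rfl

variable [Module B U] [Module Aᵐᵒᵖ U]

/-- The product of `(a 0; u b)` and `(a' 0; u' b')` has the entries `a a'`, `u a' + b u'`, `b b'`. -/
instance : Mul (TriangularRing A B U) :=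
  ⟨fun x y => ⟨x.a * y.a, MulOpposite.op y.a • x.u + x.b • y.u, x.b * y.b⟩⟩

@[simp] theorem mul_a (x y : TriangularRing A B U) : (x * y).a = x.a * y.a := rfl
@[simp] theorem mul_u (x y : TriangularRing A B U) :
    (x * y).u = MulOpposite.op y.a • x.u + x.b • y.u := rfl
@[simp] theorem mul_b (x y : TriangularRing A B U) : (x * y).b = x.b * y.b := rfl

instance [SMulCommClass B Aᵐᵒᵖ U] : Ring (TriangularRing A B U) where
  add_assoc x y z := by ext <;> simp [add_assoc]
  zero_add x := by ext <;> simp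
  add_zero x := by ext <;> simp
  add_comm x y := by ext <;> simp [add_comm]
  nsmul := nsmulRec
  zsmul := zsmulRec
  neg_add_cancel x := by ext <;> simp
  left_distrib x y z := by
    ext <;> simp [mul_add, add_smul, smul_add]
    abel
  right_distrib x y z := by
    ext <;> simp [add_mul, add_smul, smul_add]
    abel
  zero_mul x := by ext <;> simp
  mul_zero x := by ext <;> simp
  mul_assoc x y z := by
    ext <;> simp [mul_assoc, mul_smul, smul_add, add_assoc, smul_comm]
  one_mul x := by ext <;> simp
  mul_one x := by ext <;> simp

end

end TriangularRing

/-! ### The tensor product `U ⊗_A M` over a noncommutative ring `A` -/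

section BimodTensor

variable (A B U : Type u) [Ring A] [Ring B] [AddCommGroup U] [Module B U] [Module Aᵐᵒᵖ U]

/-- The relations `(u a) ⊗ m = u ⊗ (a m)` in `U ⊗_ℤ M`. The set of these relations is stable
under the left action of `B` on `U`, so that the `B`-submodule that it generates is the
subgroup that it generates. -/
def bimodTensorRel (M : Type u) [AddCommGroup M] [Module A M] : Submodule B (U ⊗[ℤ] M) :=
  Submodule.span B
    {x | ∃ (w : U) (a : A) (m : M), x = (MulOpposite.op a • w) ⊗ₜ[ℤ] m - w ⊗ₜ[ℤ] (a • m)}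

/-- `U ⊗_A M`, as a left `B`-module. -/
abbrev BimodTensor (M : Type u) [AddCommGroup M] [Module A M] : Type u :=
  (U ⊗[ℤ] M) ⧸ bimodTensorRel A B U M

variable {M N : Type u} [AddCommGroup M] [Module A M] [AddCommGroup N] [Module A N]

/-- `1_U ⊗_ℤ f`, as a `B`-linear map. -/
def intTensorMap (f : M →ₗ[A] N) : (U ⊗[ℤ] M) →ₗ[B] (U ⊗[ℤ] N) :=
  TensorProduct.AlgebraTensorModule.map (LinearMap.id : U →ₗ[B] U) f.toAddMonoidHom.toIntLinearMap

theorem bimodTensorRel_le_comap (f : M →ₗ[A] N) :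
    bimodTensorRel A B U M ≤ (bimodTensorRel A B U N).comap (intTensorMap A B U f) := by
  refine Submodule.span_le.2 ?_
  rintro _ ⟨w, a, m, rfl⟩
  refine Submodule.subset_span ⟨w, a, f m, ?_⟩
  simp [intTensorMap]

/-- `1_U ⊗_A f : U ⊗_A M → U ⊗_A N`. -/
def bimodTensorMap (f : M →ₗ[A] N) : BimodTensor A B U M →ₗ[B] BimodTensor A B U N :=
  Submodule.mapQ _ _ (intTensorMap A B U f) (bimodTensorRel_le_comap A B U f)

end BimodTensor

/-! ### Compatible bimodules -/

/-- `M` belongs to `Add_R(C)`: it is isomorphic to a direct summand of a direct sum of copies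
of `C`. -/
def IsAdd (R C M : Type u) [Ring R] [AddCommGroup C] [Module R C] [AddCommGroup M]
    [Module R M] : Prop :=
  ∃ (I : Type u) (i : M →ₗ[R] (I →₀ C)) (r : (I →₀ C) →ₗ[R] M), r ∘ₗ i = LinearMap.id

/-- A sequence of `R`-modules `⋯ → P¹ → P⁰ → C⁰ → C¹ → ⋯` is indexed by `ℤ`, with `Cⁱ = X i`
and `Pⁱ = X (-1 - i)` for `i ≥ 0`. This says that it is exact, that each `Pⁱ` is projective and
that each `Cⁱ` is in `Add_R(C)`. -/
structure IsProjAddExactSeq (R C : Type u) [Ring R] [AddCommGroup C] [Module R C]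
    (X : ℤ → Type u) [∀ n, AddCommGroup (X n)] [∀ n, Module R (X n)]
    (d : ∀ n, X n →ₗ[R] X (n + 1)) : Prop where
  exact : ∀ n, Function.Exact (d n) (d (n + 1))
  projective : ∀ n, n < 0 → Module.Projective R (X n)
  isAdd : ∀ n, 0 ≤ n → IsAdd R C (X n)

/-- The sequence `Hom_R(X, Y)` is exact. -/
def IsHomExact (R : Type u) [Ring R] {X : ℤ → Type u} [∀ n, AddCommGroup (X n)]
    [∀ n, Module R (X n)] (d : ∀ n, X n →ₗ[R] X (n + 1))
    (Y : Type u) [AddCommGroup Y] [Module R Y] : Prop :=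
  ∀ n, Function.Exact (fun g : X (n + 1 + 1) →ₗ[R] Y => g ∘ₗ d (n + 1))
    (fun g : X (n + 1) →ₗ[R] Y => g ∘ₗ d n)

/-- The `(B, A)`-bimodule `U` is `C`-compatible for `C = p(C₁, C₂) = (C₁, (U ⊗_A C₁) ⊕ C₂)`. -/
structure IsCCompatible (A B U C₁ C₂ : Type u) [Ring A] [Ring B] [AddCommGroup U] [Module B U]
    [Module Aᵐᵒᵖ U] [AddCommGroup C₁] [Module A C₁] [AddCommGroup C₂] [Module B C₂] : Prop where
  tensor_exact : ∀ (X : ℤ → Type u) [∀ n, AddCommGroup (X n)] [∀ n, Module A (X n)]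
    (d : ∀ n, X n →ₗ[A] X (n + 1)), IsProjAddExactSeq A C₁ X d →
      ∀ n, Function.Exact (bimodTensorMap A B U (d n)) (bimodTensorMap A B U (d (n + 1)))
  hom_exact : ∀ (X : ℤ → Type u) [∀ n, AddCommGroup (X n)] [∀ n, Module B (X n)]
    (d : ∀ n, X n →ₗ[B] X (n + 1)), IsProjAddExactSeq B C₂ X d →
      (∀ (Y : Type u) [AddCommGroup Y] [Module B Y], IsAdd B C₂ Y → IsHomExact B d Y) →
      ∀ (Q : Type u) [AddCommGroup Q] [Module A Q], IsAdd A C₁ Q →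
        IsHomExact B d (BimodTensor A B U Q)

/-- The `(B, A)`-bimodule `U` is compatible: it is `C`-compatible for `C = T = p(A, B)`. -/
def IsCompatibleBimodule (A B U : Type u) [Ring A] [Ring B] [AddCommGroup U] [Module B U]
    [Module Aᵐᵒᵖ U] : Prop :=
  IsCCompatible A B U A B

/-! ### Gorenstein categories and Gorenstein regular rings -/

section Gorenstein

universe v w

/-- A Grothendieck category is Gorenstein if its objects of finite projective dimension are its
objects of finite injective dimension, its finitistic projective and injective dimensions are
finite, and it has a generator of finite projective dimension. -/
structure IsGorensteinCategory (𝒜 : Type v) [Category.{w} 𝒜] [Abelian 𝒜]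
    [IsGrothendieckAbelian.{w} 𝒜] : Prop where
  finite_iff : ∀ L : 𝒜, (∃ n, HasProjectiveDimensionLE L n) ↔ ∃ n, HasInjectiveDimensionLE L n
  finitistic_projective : ∃ N, ∀ L : 𝒜, (∃ n, HasProjectiveDimensionLE L n) →
    HasProjectiveDimensionLE L N
  finitistic_injective : ∃ N, ∀ L : 𝒜, (∃ n, HasInjectiveDimensionLE L n) →
    HasInjectiveDimensionLE L N
  generator : ∃ L : 𝒜, IsSeparator L ∧ ∃ n, HasProjectiveDimensionLE L n

end Gorenstein

/-- The ring `R` is left Gorenstein regular: the category of left `R`-modules is Gorenstein. -/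
def IsLeftGorensteinRegular (R : Type u) [Ring R] : Prop :=
  IsGorensteinCategory (ModuleCat.{u} R)

/-! A module category has a projective generator, so regularity of a ring amounts to two bounds
(`isLeftGorensteinRegular_iff`): on the projective dimensions of injective modules and on the
injective dimensions of projective modules. A T-module X has components X₁ over A and X₂ over B and
sits in 0 → (0, X₂) → X → (X₁, 0) → 0, along which these bounds are moved. The functors X ↦ X₁, X ↦
X₂, M ↦ (M, 0), N ↦ (0, N) are exact, and adjunctions give half of the preservation properties
needed. The obstruction to the rest is that the second component of a projective module involves U
⊗_A Q with Q projective, and the first component of an injective module involves Hom_B(U, J) with J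
injective.

Compatibility controls both without any finiteness of U. If injective R-modules have projective
dimension at most n, embeddings into injectives and the horseshoe lemma show that every module has
an n-th syzygy which is a cycle module of a two-sided exact complex of projectives
(`AcyclicProjective.exists_isSyzygy`). Hence, if Hom(-, Y) keeps all such complexes exact, Y has
injective dimension at most n (`AcyclicProjective.hasInjectiveDimensionLE`). By tensor-hom
adjunction, condition (a) yields this for Hom_B(U, J). Condition (b) yields it for U ⊗_A Q when B is
regular, its Hom-exactness premise being automatic because projective B-modules have finite
injective dimension.

So X₁ for X injective and P₂ for P projective have finite injective dimension, and therefore finite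
projective dimension over a regular ring; the sequence above does the rest. Descent from T to A and
B needs only (a), once injective A-modules are known to have bounded projective dimension. -/

/-! ### Dimension bounds along exact functors and resolutions -/

section Functor

universe v₁ v₂ u₁ u₂

variable {C : Type u₁} [Category.{v₁} C] [Abelian C] {D : Type u₂} [Category.{v₂} D] [Abelian D]
  (F : C ⥤ D) [F.PreservesZeroMorphisms]

/-- An exact functor which sends injective objects to objects of injective dimension at most `k`
raises injective dimensions by at most `k`. -/
theorem hasInjectiveDimensionLE_obj [EnoughInjectives C]
    (hF : ∀ S : ShortComplex C, S.ShortExact → (S.map F).ShortExact) {k : ℕ}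
    (hI : ∀ I : C, Injective I → HasInjectiveDimensionLE (F.obj I) k) (n : ℕ) (X : C)
    (hX : HasInjectiveDimensionLE X n) : HasInjectiveDimensionLE (F.obj X) (n + k) := by
  induction n generalizing X with
  | zero =>
    rw [Nat.zero_add]
    exact hI X (injective_iff_hasInjectiveDimensionLT_one.2 hX)
  | succ n ih =>
    obtain ⟨p⟩ := EnoughInjectives.presentation X
    have hS : (ShortComplex.mk _ _ (Limits.cokernel.condition p.f)).ShortExact :=
      { exact := ShortComplex.exact_cokernel p.f }
    have h₃ := ih _ ((hS.hasInjectiveDimensionLT_X₃_iff n p.injective).2 hX)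
    have h₂ := hI _ p.injective
    -- `HasInjectiveDimensionLE _ m` is `HasInjectiveDimensionLT _ (m + 1)`, which accounts for the
    -- extra ones here and below.
    have := (hF _ hS).hasInjectiveDimensionLT_X₁ (n + k + 1) h₃
      (@hasInjectiveDimensionLT_of_ge _ _ _ _ (k + 1) (n + k + 1 + 1) (by lia) h₂)
    exact @hasInjectiveDimensionLT_of_ge _ _ _ _ (n + k + 1 + 1) _ (by lia) this

/-- An exact functor which sends projective objects to objects of projective dimension at most `k`
raises projective dimensions by at most `k`. -/
theorem hasProjectiveDimensionLE_obj [EnoughProjectives C]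
    (hF : ∀ S : ShortComplex C, S.ShortExact → (S.map F).ShortExact) {k : ℕ}
    (hP : ∀ P : C, Projective P → HasProjectiveDimensionLE (F.obj P) k) (n : ℕ) (X : C)
    (hX : HasProjectiveDimensionLE X n) : HasProjectiveDimensionLE (F.obj X) (n + k) := by
  induction n generalizing X with
  | zero =>
    rw [Nat.zero_add]
    exact hP X (projective_iff_hasProjectiveDimensionLT_one.2 hX)
  | succ n ih =>
    obtain ⟨p⟩ := EnoughProjectives.presentation X
    have hS : (ShortComplex.mk _ _ (Limits.kernel.condition p.f)).ShortExact :=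
      { exact := ShortComplex.exact_kernel p.f }
    have h₁ := ih _ ((hS.hasProjectiveDimensionLT_X₃_iff n p.projective).1 hX)
    have h₂ := hP _ p.projective
    have := (hF _ hS).hasProjectiveDimensionLT_X₃ (n + k + 1) h₁
      (@hasProjectiveDimensionLT_of_ge _ _ _ _ (k + 1) (n + k + 1 + 1) (by lia) h₂)
    exact @hasProjectiveDimensionLT_of_ge _ _ _ _ (n + k + 1 + 1) _ (by lia) this

/-- An exact functor which preserves and reflects projective objects reflects projective
dimensions. -/
theorem hasProjectiveDimensionLE_of_obj [EnoughProjectives C]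
    (hF : ∀ S : ShortComplex C, S.ShortExact → (S.map F).ShortExact)
    (hP : ∀ P : C, Projective (F.obj P) ↔ Projective P) (n : ℕ) (X : C)
    (hX : HasProjectiveDimensionLE (F.obj X) n) : HasProjectiveDimensionLE X n := by
  induction n generalizing X with
  | zero =>
    exact projective_iff_hasProjectiveDimensionLT_one.1
      ((hP X).1 (projective_iff_hasProjectiveDimensionLT_one.2 hX))
  | succ n ih =>
    obtain ⟨p⟩ := EnoughProjectives.presentation X
    have hS : (ShortComplex.mk _ _ (Limits.kernel.condition p.f)).ShortExact :=
      { exact := ShortComplex.exact_kernel p.f }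
    exact (hS.hasProjectiveDimensionLT_X₃_iff n p.projective).2
      (ih _ (((hF _ hS).hasProjectiveDimensionLT_X₃_iff n ((hP _).2 p.projective)).1 hX))

/-- If the injective dimensions of the projective objects are at most `k`, then so are those of
the objects of finite projective dimension. -/
theorem hasInjectiveDimensionLE_of_hasProjectiveDimensionLE [EnoughProjectives C] {k : ℕ}
    (hP : ∀ P : C, Projective P → HasInjectiveDimensionLE P k) (n : ℕ) (X : C)
    (hX : HasProjectiveDimensionLE X n) : HasInjectiveDimensionLE X k := by
  induction n generalizing X with
  | zero => exact hP X (projective_iff_hasProjectiveDimensionLT_one.2 hX)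
  | succ n ih =>
    obtain ⟨p⟩ := EnoughProjectives.presentation X
    have hS : (ShortComplex.mk _ _ (Limits.kernel.condition p.f)).ShortExact :=
      { exact := ShortComplex.exact_kernel p.f }
    have h₁ := ih _ ((hS.hasProjectiveDimensionLT_X₃_iff n p.projective).1 hX)
    -- A quotient of two objects of injective dimension at most `k` again satisfies this bound, so
    -- it does not grow with `n`.
    exact hS.hasInjectiveDimensionLT_X₃ (k + 1) (hP _ p.projective)
      (@hasInjectiveDimensionLT_of_ge _ _ _ _ (k + 1) (k + 1 + 1) (by lia) h₁)

/-- If the projective dimensions of the injective objects are at most `k`, then so are those of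
the objects of finite injective dimension. -/
theorem hasProjectiveDimensionLE_of_hasInjectiveDimensionLE [EnoughInjectives C] {k : ℕ}
    (hI : ∀ I : C, Injective I → HasProjectiveDimensionLE I k) (n : ℕ) (X : C)
    (hX : HasInjectiveDimensionLE X n) : HasProjectiveDimensionLE X k := by
  induction n generalizing X with
  | zero => exact hI X (injective_iff_hasInjectiveDimensionLT_one.2 hX)
  | succ n ih =>
    obtain ⟨p⟩ := EnoughInjectives.presentation X
    have hS : (ShortComplex.mk _ _ (Limits.cokernel.condition p.f)).ShortExact :=
      { exact := ShortComplex.exact_cokernel p.f }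
    have h₃ := ih _ ((hS.hasInjectiveDimensionLT_X₃_iff n p.injective).2 hX)
    exact hS.hasProjectiveDimensionLT_X₁ (k + 1) (hI _ p.injective)
      (@hasProjectiveDimensionLT_of_ge _ _ _ _ (k + 1) (k + 1 + 1) (by lia) h₃)

end Functor

/-- A ring is left Gorenstein regular if and only if the projective dimensions of its injective
modules and the injective dimensions of its projective modules are bounded. -/
theorem isLeftGorensteinRegular_iff (R : Type u) [Ring R] :
    IsLeftGorensteinRegular R ↔
      (∃ N, ∀ I : ModuleCat.{u} R, Injective I → HasProjectiveDimensionLE I N) ∧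
      ∃ N, ∀ P : ModuleCat.{u} R, Projective P → HasInjectiveDimensionLE P N := by
  constructor
  · rintro ⟨h, ⟨N, hN⟩, ⟨N', hN'⟩, -⟩
    refine ⟨⟨N, fun I _ => hN I ((h I).2 ⟨0, ?_⟩)⟩, N', fun P _ => hN' P ((h P).1 ⟨0, ?_⟩)⟩
    · exact injective_iff_hasInjectiveDimensionLT_one.1 inferInstance
    · exact projective_iff_hasProjectiveDimensionLT_one.1 inferInstance
  · rintro ⟨⟨N, hN⟩, N', hN'⟩
    have h₁ := hasProjectiveDimensionLE_of_hasInjectiveDimensionLE hN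
    have h₂ := hasInjectiveDimensionLE_of_hasProjectiveDimensionLE hN'
    refine ⟨fun L => ⟨fun ⟨n, hn⟩ => ⟨_, h₂ n L hn⟩, fun ⟨n, hn⟩ => ⟨_, h₁ n L hn⟩⟩,
      ⟨N, fun L ⟨n, hn⟩ => h₁ _ L (h₂ n L hn)⟩, ⟨N', fun L ⟨n, hn⟩ => h₂ _ L (h₁ n L hn)⟩,
      ⟨ModuleCat.of R (Shrink.{u} R), ModuleCat.isSeparator R, 0, ?_⟩⟩
    -- The generator is a copy of `R`, so it has projective dimension zero.
    have : Module.Projective R (Shrink.{u} R) :=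
      Module.Projective.of_equiv (Shrink.linearEquiv R R).symm
    exact projective_iff_hasProjectiveDimensionLT_one.1 inferInstance

/-! ### Syzygies and Ext -/

section Linear

variable {R : Type u} [Ring R]

theorem ModuleCat.shortExact_ofHom {K M N : ModuleCat.{u} R} {f : K →ₗ[R] M} {g : M →ₗ[R] N}
    (hf : Function.Injective f) (h : Function.Exact f g) (hg : Function.Surjective g) :
    (ShortComplex.mk (ModuleCat.ofHom f) (ModuleCat.ofHom g)
      (by ext x; exact h.apply_apply_eq_zero x)).ShortExact :=
  ModuleCat.shortComplex_shortExact _ h hf hg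

/-- `K` is the kernel of an epimorphism from a projective module to `M`. -/
def IsFirstSyzygy (K M : ModuleCat.{u} R) : Prop :=
  ∃ (P : ModuleCat.{u} R) (ι : K →ₗ[R] P) (π : P →ₗ[R] M), Module.Projective R P ∧
    Function.Injective ι ∧ Function.Exact ι π ∧ Function.Surjective π

theorem exists_isFirstSyzygy (M : ModuleCat.{u} R) : ∃ K, IsFirstSyzygy K M := by
  obtain ⟨p⟩ := EnoughProjectives.presentation M
  have := p.projective
  exact ⟨ModuleCat.of R (LinearMap.ker p.f.hom), p.p, Submodule.subtype _, p.f.hom,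
    inferInstance, Subtype.val_injective, LinearMap.exact_subtype_ker_map _,
    (ModuleCat.epi_iff_surjective _).1 p.epi⟩

open Abelian in
-- Dimension shifting: the positive Ext groups of the projective middle term vanish. Degree zero is
-- excluded, as there maps from the middle term interfere.
theorem IsFirstSyzygy.subsingleton_ext_iff {K M : ModuleCat.{u} R} (h : IsFirstSyzygy K M)
    (Y : ModuleCat.{u} R) (j : ℕ) :
    Subsingleton (Ext.{u} K Y (j + 1)) ↔ Subsingleton (Ext.{u} M Y (j + 1 + 1)) := by
  obtain ⟨P, ι, π, hP, hι, hex, hπ⟩ := h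
  have hS := ModuleCat.shortExact_ofHom hι hex hπ
  constructor
  · intro hK
    refine ⟨fun x y => ?_⟩
    suffices ∀ x : Ext.{u} M Y (j + 1 + 1), x = 0 by rw [this x, this y]
    intro x
    obtain ⟨z, rfl⟩ := Ext.contravariant_sequence_exact₃ hS Y x
      (Ext.eq_zero_of_projective (P := P) _) (by lia : 1 + (j + 1) = j + 1 + 1)
    rw [Subsingleton.elim (α := Ext.{u} K Y (j + 1)) z 0, Ext.comp_zero]
  · intro hM
    refine ⟨fun x y => ?_⟩
    suffices ∀ x : Ext.{u} K Y (j + 1), x = 0 by rw [this x, this y]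
    intro x
    obtain ⟨z, rfl⟩ := Ext.contravariant_sequence_exact₁ hS Y x
      (by lia : 1 + (j + 1) = j + 1 + 1) (Subsingleton.elim (α := Ext.{u} M Y (j + 1 + 1)) _ _)
    rw [Ext.eq_zero_of_projective (P := P) z, Ext.comp_zero]

open Abelian in
-- The low-degree case: Ext¹(M, Y) is the cokernel of Hom(P, Y) → Hom(K, Y). It translates exactness
-- of Hom complexes into vanishing of Ext¹.
theorem exists_extension_iff_subsingleton_ext {K P M : ModuleCat.{u} R} {ι : K →ₗ[R] P}
    {π : P →ₗ[R] M} (hP : Module.Projective R P) (hι : Function.Injective ι)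
    (hex : Function.Exact ι π) (hπ : Function.Surjective π) (Y : ModuleCat.{u} R) :
    (∀ f : K →ₗ[R] Y, ∃ g : P →ₗ[R] Y, g ∘ₗ ι = f) ↔ Subsingleton (Ext.{u} M Y 1) := by
  have hS := ModuleCat.shortExact_ofHom hι hex hπ
  constructor
  · intro h
    refine ⟨fun x y => ?_⟩
    suffices ∀ x : Ext.{u} M Y 1, x = 0 by rw [this x, this y]
    intro x
    obtain ⟨z, rfl⟩ := Ext.contravariant_sequence_exact₃ hS Y x
      (Ext.eq_zero_of_projective (P := P) _) (by lia : 1 + 0 = 1)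
    obtain ⟨f, rfl⟩ := (Ext.mk₀_bijective _ _).2 z
    obtain ⟨g, hg⟩ := h f.hom
    have : f = ModuleCat.ofHom ι ≫ ModuleCat.ofHom g := by
      ext x
      exact (LinearMap.congr_fun hg x).symm
    rw [this, ← Ext.mk₀_comp_mk₀]
    exact hS.extClass_comp_assoc _
  · intro hM f
    obtain ⟨z, hz⟩ := Ext.contravariant_sequence_exact₁ hS Y (Ext.mk₀ (ModuleCat.ofHom f))
      (by lia : 1 + 0 = 1) (Subsingleton.elim (α := Ext.{u} M Y 1) _ _)
    obtain ⟨g, rfl⟩ := (Ext.mk₀_bijective _ _).2 z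
    refine ⟨g.hom, ?_⟩
    rw [Ext.mk₀_comp_mk₀] at hz
    exact congrArg ModuleCat.Hom.hom ((Ext.mk₀_bijective _ _).1 hz)

/-- `K` is an `n`-th syzygy of `M`. -/
inductive IsSyzygy : ℕ → ModuleCat.{u} R → ModuleCat.{u} R → Prop
  | zero (M : ModuleCat.{u} R) : IsSyzygy 0 M M
  | succ {n : ℕ} {K L M : ModuleCat.{u} R} (h : IsSyzygy n K L) (h' : IsFirstSyzygy L M) :
      IsSyzygy (n + 1) K M

theorem exists_isSyzygy (n : ℕ) (M : ModuleCat.{u} R) : ∃ K, IsSyzygy n K M := by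
  induction n generalizing M with
  | zero => exact ⟨M, .zero M⟩
  | succ n ih =>
    obtain ⟨L, hL⟩ := exists_isFirstSyzygy M
    obtain ⟨K, hK⟩ := ih L
    exact ⟨K, .succ hK hL⟩

/-- The inductive definition adds a step at `M`; this adds one at the other end. Reading a chain
from both ends allows complexes to be continued to the left. -/
theorem IsSyzygy.cons {n : ℕ} {K L M : ModuleCat.{u} R} (h : IsSyzygy n L M)
    (h' : IsFirstSyzygy K L) : IsSyzygy (n + 1) K M := by
  induction h with
  | zero M => exact .succ (.zero K) h'
  | succ _ h₁ ih => exact .succ (ih h') h₁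

open Abelian in
theorem IsSyzygy.subsingleton_ext {n : ℕ} {K M : ModuleCat.{u} R} (h : IsSyzygy n K M)
    (Y : ModuleCat.{u} R) (hK : Subsingleton (Ext.{u} K Y 1)) :
    Subsingleton (Ext.{u} M Y (n + 1)) := by
  induction h with
  | zero M => exact hK
  | succ _ h₁ ih => exact (h₁.subsingleton_ext_iff Y _).1 (ih hK)

/-- The horseshoe lemma. -/
theorem IsFirstSyzygy.horseshoe {M₁ M I M' : ModuleCat.{u} R} (h : IsFirstSyzygy M₁ M)
    {j : M →ₗ[R] I} {q : I →ₗ[R] M'} (hj : Function.Injective j) (hex : Function.Exact j q)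
    (hq : Function.Surjective q) :
    ∃ (I₁ M₁' : ModuleCat.{u} R) (j₁ : M₁ →ₗ[R] I₁) (q₁ : I₁ →ₗ[R] M₁'),
      IsFirstSyzygy I₁ I ∧ IsFirstSyzygy M₁' M' ∧ Function.Injective j₁ ∧
      Function.Exact j₁ q₁ ∧ Function.Surjective q₁ := by
  obtain ⟨P, ι, π, hP, hι, hιπ, hπ⟩ := h
  obtain ⟨p⟩ := EnoughProjectives.presentation M'
  have := p.projective
  have hP' : Module.Projective R p.p := inferInstance
  have hp : Function.Surjective p.f.hom := (ModuleCat.epi_iff_surjective _).1 p.epi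
  obtain ⟨s, hs⟩ := Module.projective_lifting_property q p.f.hom hq
  have hs' : ∀ y, q (s y) = p.f.hom y := fun y => LinearMap.congr_fun hs y
  -- The lift `s` of the cover of `M'` makes `I` a quotient of the sum of the two covers; the kernel
  -- of `t` is the middle syzygy.
  let t : P × p.p →ₗ[R] I := (j ∘ₗ π).coprod s
  have ht : Function.Surjective t := by
    intro x
    obtain ⟨y, hy⟩ := hp (q x)
    obtain ⟨m, hm⟩ := (hex (x - s y)).1 (by rw [map_sub, hs', hy, sub_self])
    obtain ⟨z, rfl⟩ := hπ m
    exact ⟨(z, y), by simp [t, hm]⟩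
  have hker : ∀ x : LinearMap.ker t, j (π x.1.1) + s x.1.2 = 0 := fun x => x.2
  refine ⟨ModuleCat.of R (LinearMap.ker t), ModuleCat.of R (LinearMap.ker p.f.hom),
    (LinearMap.inl R P p.p ∘ₗ ι).codRestrict (LinearMap.ker t) fun x => ?_,
    (LinearMap.snd R P p.p ∘ₗ (LinearMap.ker t).subtype).codRestrict
      (LinearMap.ker p.f.hom) fun x => ?_,
    ⟨ModuleCat.of R (P × p.p), (LinearMap.ker t).subtype, t, ?_, Subtype.val_injective,
      LinearMap.exact_subtype_ker_map t, ht⟩,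
    ⟨p.p, (LinearMap.ker p.f.hom).subtype, p.f.hom, inferInstance, Subtype.val_injective,
      LinearMap.exact_subtype_ker_map _, hp⟩, ?_, ?_, ?_⟩
  · simp [t, hιπ.apply_apply_eq_zero]
  · have h₁ := congrArg q (hker x)
    rw [map_add, hex.apply_apply_eq_zero, zero_add, map_zero, hs'] at h₁
    exact h₁
  · exact inferInstanceAs (Module.Projective R (P × p.p))
  · intro x y hxy
    exact hι (congrArg (fun z : LinearMap.ker t => z.1.1) hxy)
  · rintro ⟨⟨x, y⟩, hxy⟩
    constructor
    · intro hy
      obtain rfl : y = 0 := congrArg Subtype.val hy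
      have hx : j (π x) = 0 := by simpa [t] using hxy
      obtain ⟨z, rfl⟩ := (hιπ x).1 (hj (hx.trans (map_zero j).symm))
      exact ⟨z, rfl⟩
    · rintro ⟨z, hz⟩
      have := congrArg (fun z : LinearMap.ker t => z.1.2) hz
      exact Subtype.ext this.symm
  · rintro ⟨y, hy⟩
    obtain ⟨m, hm⟩ := (hex (s y)).1 ((hs' y).trans hy)
    obtain ⟨z, rfl⟩ := hπ m
    exact ⟨⟨(-z, y), by simp [t, hm]⟩, rfl⟩

theorem IsFirstSyzygy.hasProjectiveDimensionLE {K M : ModuleCat.{u} R} (h : IsFirstSyzygy K M)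
    {n : ℕ} (hM : HasProjectiveDimensionLE M (n + 1)) : HasProjectiveDimensionLE K n := by
  obtain ⟨P, ι, π, hP, hι, hex, hπ⟩ := h
  exact ((ModuleCat.shortExact_ofHom hι hex hπ).hasProjectiveDimensionLT_X₃_iff n
    (inferInstanceAs (Projective P))).1 hM

/-- If `M` is a submodule of a module of projective dimension at most `n`, then an `n`-th syzygy
of `M` is a submodule of a projective module such that the quotient is an `n`-th syzygy. -/
theorem IsSyzygy.exists_right {n : ℕ} {K M : ModuleCat.{u} R} (h : IsSyzygy n K M)
    {I M' : ModuleCat.{u} R} {j : M →ₗ[R] I} {q : I →ₗ[R] M'} (hj : Function.Injective j)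
    (hex : Function.Exact j q) (hq : Function.Surjective q) (hI : HasProjectiveDimensionLE I n) :
    ∃ K', IsSyzygy n K' M' ∧ IsFirstSyzygy K K' := by
  induction h generalizing I M' with
  | zero M =>
    -- Here `I` is projective, so `M` itself is a first syzygy of `M'`.
    have := projective_iff_hasProjectiveDimensionLT_one.2 hI
    exact ⟨M', .zero M', I, j, q, inferInstance, hj, hex, hq⟩
  | succ _ h₁ ih =>
    -- Taking syzygies of the whole short exact sequence lowers the bound on the middle term by one.
    obtain ⟨I₁, M₁', j₁, q₁, hI₁, hM₁', hj₁, hex₁, hq₁⟩ := h₁.horseshoe hj hex hq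
    obtain ⟨K', hK', hKK'⟩ := ih hj₁ hex₁ hq₁ (hI₁.hasProjectiveDimensionLE hI)
    exact ⟨K', .succ hK' hM₁', hKK'⟩

end Linear

/-! ### Two-sided exact complexes of projective modules -/

/-- Chosen successors are iterated to the right of `a` and chosen predecessors to its left; `p` is
the invariant that keeps both choices possible. -/
theorem exists_int_seq {α : Type*} (r : α → α → Prop) (p : α → Prop)
    (hr : ∀ a, p a → ∃ b, p b ∧ r a b) (hl : ∀ a, p a → ∃ b, p b ∧ r b a) (a : α) (ha : p a)
    (i : ℤ) : ∃ f : ℤ → α, f i = a ∧ ∀ n, r (f n) (f (n + 1)) := by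
  choose! s hs hs' using hr
  choose! t ht ht' using hl
  have hsn (n : ℕ) : p (s^[n] a) := by
    induction n with
    | zero => exact ha
    | succ n ih => rw [Function.iterate_succ_apply']; exact hs _ ih
  have htn (n : ℕ) : p (t^[n] a) := by
    induction n with
    | zero => exact ha
    | succ n ih => rw [Function.iterate_succ_apply']; exact ht _ ih
  let f : ℤ → α
    | Int.ofNat n => s^[n] a
    | Int.negSucc n => t^[n + 1] a
  have hf : ∀ n, r (f n) (f (n + 1)) := by
    rintro (n | n)
    · change r (s^[n] a) (s^[n + 1] a)
      rw [Function.iterate_succ_apply']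
      exact hs' _ (hsn n)
    · have : f (Int.negSucc n + 1) = t^[n] a := by
        cases n <;> rfl
      rw [this]
      change r (t^[n + 1] a) _
      rw [Function.iterate_succ_apply']
      exact ht' _ (htn n)
  -- `f` has `a` at position zero; the translation moves it to `i`.
  refine ⟨fun n => f (n - i), ?_, fun n => ?_⟩
  · change f (i - i) = a
    rw [sub_self]
    rfl
  · have := hf (n - i)
    rwa [show n - i + 1 = n + 1 - i by ring] at this

/-- An exact sequence of projective modules, indexed by `ℤ`, as the splice of the short exact
sequences `0 → K n → P n → K (n + 1) → 0`. -/
structure AcyclicProjective (R : Type u) [Ring R] where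
  K : ℤ → ModuleCat.{u} R
  P : ℤ → ModuleCat.{u} R
  ι : ∀ n, K n →ₗ[R] P n
  π : ∀ n, P n →ₗ[R] K (n + 1)
  projective : ∀ n, Module.Projective R (P n)
  injective : ∀ n, Function.Injective (ι n)
  exact : ∀ n, Function.Exact (ι n) (π n)
  surjective : ∀ n, Function.Surjective (π n)

/-- A projective module belongs to `Add_R(R)`. -/
theorem isAdd_of_projective (R P : Type u) [Ring R] [AddCommGroup P] [Module R P]
    [Module.Projective R P] : IsAdd R R P := by
  obtain ⟨s, hs⟩ := (Module.projective_def' (R := R) (P := P)).1 inferInstance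
  exact ⟨P, s, _, hs⟩

/-- A module in `Add_R(R)` is projective. -/
theorem IsAdd.projective {R P : Type u} [Ring R] [AddCommGroup P] [Module R P]
    (h : IsAdd R R P) : Module.Projective R P := by
  obtain ⟨I, i, r, h⟩ := h
  exact Module.Projective.of_split i r h

namespace AcyclicProjective

open Abelian

variable {R : Type u} [Ring R]

/-- The differential of the exact sequence. -/
def d (S : AcyclicProjective R) (n : ℤ) : S.P n →ₗ[R] S.P (n + 1) :=
  S.ι (n + 1) ∘ₗ S.π n

theorem isProjAddExactSeq (S : AcyclicProjective R) :
    IsProjAddExactSeq R R (fun n => S.P n) S.d where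
  exact n := by
    intro x
    constructor
    · intro hx
      have hx' : S.π (n + 1) x = 0 :=
        S.injective (n + 1 + 1) (hx.trans (map_zero (S.ι (n + 1 + 1))).symm)
      obtain ⟨y, rfl⟩ := (S.exact _ x).1 hx'
      obtain ⟨z, rfl⟩ := S.surjective n y
      exact ⟨z, rfl⟩
    · rintro ⟨z, rfl⟩
      simp [d, (S.exact _).apply_apply_eq_zero]
  projective n _ := S.projective n
  isAdd n _ := have := S.projective n; isAdd_of_projective R (S.P n)

/-- Since the complex never ends on the right, Ext¹ at one cycle module can be shifted to Ext of
degree `m + 1` at a later one, where it vanishes. -/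
theorem subsingleton_ext_of_hasInjectiveDimensionLE (S : AcyclicProjective R)
    (Y : ModuleCat.{u} R) {m : ℕ} (hY : HasInjectiveDimensionLE Y m) (n : ℤ) :
    Subsingleton (Ext.{u} (S.K n) Y 1) := by
  suffices ∀ (k : ℕ) (j : ℕ), m ≤ k + j → ∀ n, Subsingleton (Ext.{u} (S.K n) Y (j + 1)) from
    this m 0 (by lia) n
  intro k
  induction k with
  | zero =>
    intro j hj n
    exact HasInjectiveDimensionLT.subsingleton Y (m + 1) (j + 1) (by lia) _
  | succ k ih =>
    intro j hj n
    have h : IsFirstSyzygy (S.K n) (S.K (n + 1)) :=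
      ⟨S.P n, S.ι n, S.π n, S.projective n, S.injective n, S.exact n, S.surjective n⟩
    exact (h.subsingleton_ext_iff Y j).2 (ih (j + 1) (by lia) _)

/-- An exact sequence of projective modules remains exact under `Hom(-, Y)` if `Y` has finite
injective dimension. -/
theorem isHomExact (S : AcyclicProjective R) (Y : ModuleCat.{u} R) {m : ℕ}
    (hY : HasInjectiveDimensionLE Y m) : IsHomExact R (X := fun n => S.P n) S.d Y := by
  intro n g
  constructor
  · intro hg
    have hg' : LinearMap.ker (S.π (n + 1)) ≤ LinearMap.ker g := by
      intro x hx
      obtain ⟨y, rfl⟩ := (S.exact _ x).1 hx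
      obtain ⟨z, rfl⟩ := S.surjective n y
      exact LinearMap.congr_fun hg z
    -- A cocycle factors through the next cycle module; vanishing of Ext¹ then extends it to the
    -- next projective.
    obtain ⟨h, hh⟩ : ∃ h : S.K (n + 1 + 1) →ₗ[R] Y, h ∘ₗ S.π (n + 1) = g := by
      refine ⟨(LinearMap.ker (S.π (n + 1))).liftQ g hg' ∘ₗ
        ((S.π (n + 1)).quotKerEquivOfSurjective (S.surjective _)).symm.toLinearMap, ?_⟩
      ext x
      simp
    obtain ⟨g', hg'⟩ := (exists_extension_iff_subsingleton_ext (S.projective (n + 1 + 1))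
      (S.injective _) (S.exact _) (S.surjective _) Y).2
      (S.subsingleton_ext_of_hasInjectiveDimensionLE Y hY _) h
    refine ⟨g', ?_⟩
    change g' ∘ₗ S.ι (n + 1 + 1) ∘ₗ S.π (n + 1) = g
    rw [← LinearMap.comp_assoc, hg', hh]
  · rintro ⟨g', rfl⟩
    ext x
    change g' (S.d (n + 1) (S.d n x)) = 0
    rw [(S.isProjAddExactSeq.exact n).apply_apply_eq_zero, map_zero]

/-- A map on a cycle module, composed with the surjection onto that module, is a cocycle; bounding
it gives the extension after cancelling the surjection. The index names the cokernel of the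
inclusion along which one extends. -/
theorem subsingleton_ext_of_isHomExact (S : AcyclicProjective R) (Y : ModuleCat.{u} R)
    (hY : IsHomExact R (X := fun n => S.P n) S.d Y) (n : ℤ) :
    Subsingleton (Ext.{u} (S.K (n + 1 + 1 + 1)) Y 1) := by
  refine (exists_extension_iff_subsingleton_ext (S.projective (n + 1 + 1))
      (S.injective _) (S.exact _) (S.surjective _) Y).1 fun f => ?_
  obtain ⟨g, hg⟩ := (hY n (f ∘ₗ S.π (n + 1))).1 <| by
    ext x
    simp [d, (S.exact _).apply_apply_eq_zero]
  refine ⟨g, ?_⟩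
  ext x
  obtain ⟨y, rfl⟩ := S.surjective _ x
  exact LinearMap.congr_fun hg y

/-- If the injective modules have projective dimension at most `n`, then every module has an
`n`-th syzygy which is a module of cycles of an exact sequence of projective modules. -/
theorem exists_isSyzygy {n : ℕ}
    (hR : ∀ I : ModuleCat.{u} R, Injective I → HasProjectiveDimensionLE I n)
    (M : ModuleCat.{u} R) (i : ℤ) : ∃ S : AcyclicProjective R, IsSyzygy n (S.K i) M := by
  obtain ⟨K, hK⟩ := _root_.exists_isSyzygy n M
  obtain ⟨f, hf, hr⟩ := exists_int_seq (fun K K' : ModuleCat.{u} R => IsFirstSyzygy K K')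
    (fun K => ∃ M, IsSyzygy n K M)
    (by
      rintro K ⟨M, hKM⟩
      -- To the right: `M` embeds in an injective module, whose projective dimension is at most `n`,
      -- so `exists_right` applies.
      obtain ⟨p⟩ := EnoughInjectives.presentation M
      have hp : Function.Injective p.f.hom := (ModuleCat.mono_iff_injective _).1 p.mono
      obtain ⟨K', hK', h⟩ := hKM.exists_right (M' := ModuleCat.of R (p.J ⧸ LinearMap.range p.f.hom))
        (q := Submodule.mkQ _) hp (LinearMap.exact_map_mkQ_range _)
        (Submodule.mkQ_surjective _) (hR _ p.injective)
      exact ⟨K', ⟨_, hK'⟩, h⟩)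
    (by
      rintro K ⟨M, hKM⟩
      -- To the left: a syzygy of `K` is an (n + 1)-st syzygy of `M`, hence an n-th syzygy of a
      -- first syzygy of `M`.
      obtain ⟨L, hL⟩ := exists_isFirstSyzygy K
      cases hKM.cons hL with
      | succ h _ => exact ⟨L, ⟨_, h⟩, hL⟩) K ⟨M, hK⟩ i
  choose P ι π h₁ h₂ h₃ h₄ using hr
  exact ⟨⟨f, P, ι, π, h₁, h₂, h₃, h₄⟩, by rwa [← hf] at hK⟩

/-- If the injective modules have projective dimension at most `n`, and all exact sequences of
projective modules remain exact under `Hom(-, Y)`, then the injective dimension of `Y` is at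
most `n`. -/
theorem hasInjectiveDimensionLE {n : ℕ}
    (hR : ∀ I : ModuleCat.{u} R, Injective I → HasProjectiveDimensionLE I n)
    (Y : ModuleCat.{u} R)
    (hY : ∀ S : AcyclicProjective R, IsHomExact R (X := fun n => S.P n) S.d Y) :
    HasInjectiveDimensionLE Y n := by
  refine hasInjectiveDimensionLT_of_enoughProjectives Y (n + 1) fun M => ?_
  obtain ⟨S, hS⟩ := exists_isSyzygy hR M (0 + 1 + 1 + 1)
  exact hS.subsingleton_ext Y (S.subsingleton_ext_of_isHomExact Y (hY S) 0)

end AcyclicProjective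

/-! ### Corners of modules -/

section Corner

variable {R S : Type u} [Ring R] [Ring S] (j : S →ₙ+* R)

/-- The corner `e X` of an `R`-module `X`, for the idempotent `e = j 1`. -/
def Corner (X : Type u) [AddCommGroup X] [Module R X] : AddSubgroup X where
  carrier := {x | j 1 • x = x}
  add_mem' {x y} hx hy := by
    change j 1 • (x + y) = x + y
    rw [smul_add, hx, hy]
  zero_mem' := smul_zero _
  neg_mem' {x} hx := by
    change j 1 • (-x) = -x
    rw [smul_neg, hx]

namespace Corner

variable {X Y Z : Type u} [AddCommGroup X] [Module R X] [AddCommGroup Y] [Module R Y]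
  [AddCommGroup Z] [Module R Z]

theorem smul_mem (s : S) (x : X) : j s • x ∈ Corner j X := by
  change j 1 • j s • x = j s • x
  rw [smul_smul, ← map_mul, one_mul]

instance : SMul S (Corner j X) := ⟨fun s x => ⟨j s • x.1, smul_mem j s x.1⟩⟩

@[simp] theorem coe_smul (s : S) (x : Corner j X) : (s • x).1 = j s • x.1 := rfl

instance : Module S (Corner j X) where
  one_smul x := Subtype.ext x.2
  mul_smul s t x := Subtype.ext (by simp [mul_smul])
  smul_zero s := Subtype.ext (by simp)
  smul_add s x y := Subtype.ext (by simp)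
  add_smul s t x := Subtype.ext (by simp [add_smul])
  zero_smul x := Subtype.ext (by simp)

/-- The restriction of a linear map to the corners. -/
def map (f : X →ₗ[R] Y) : Corner j X →ₗ[S] Corner j Y where
  toFun x := ⟨f x, by
    change j 1 • f x = f x
    rw [← map_smul]
    exact congrArg f x.2⟩
  map_add' x y := Subtype.ext (by simp)
  map_smul' s x := Subtype.ext (by simp)

@[simp] theorem coe_map (f : X →ₗ[R] Y) (x : Corner j X) : (map j f x : Y) = f x := rfl

theorem map_injective {f : X →ₗ[R] Y} (hf : Function.Injective f) :
    Function.Injective (map j f) := fun _ _ h => Subtype.ext (hf (congrArg Subtype.val h))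

/-- Any preimage of a corner element can be multiplied by the idempotent; this is also why passing
to corners preserves exactness. -/
theorem map_surjective {f : X →ₗ[R] Y} (hf : Function.Surjective f) :
    Function.Surjective (map j f) := by
  rintro ⟨y, hy⟩
  obtain ⟨x, rfl⟩ := hf y
  exact ⟨⟨j 1 • x, smul_mem j 1 x⟩, Subtype.ext ((map_smul _ _ _).trans hy)⟩

theorem map_exact {f : X →ₗ[R] Y} {g : Y →ₗ[R] Z} (h : Function.Exact f g) :
    Function.Exact (map j f) (map j g) := by
  rintro ⟨y, hy⟩
  constructor
  · intro h₀
    obtain ⟨x, rfl⟩ := (h y).1 (congrArg Subtype.val h₀)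
    exact ⟨⟨j 1 • x, smul_mem j 1 x⟩, Subtype.ext ((map_smul _ _ _).trans hy)⟩
  · rintro ⟨x, hx⟩
    rw [← hx]
    exact Subtype.ext (h.apply_apply_eq_zero (x : X))

end Corner

/-- The functor which sends an `R`-module to its corner. -/
def cornerFunctor : ModuleCat.{u} R ⥤ ModuleCat.{u} S where
  obj X := ModuleCat.of S (Corner j X)
  map f := ModuleCat.ofHom (Corner.map j f.hom)
  map_id _ := rfl
  map_comp _ _ := rfl

instance : (cornerFunctor j).PreservesZeroMorphisms where
  map_zero _ _ := rfl

theorem cornerFunctor_shortExact (C : ShortComplex (ModuleCat.{u} R)) (hC : C.ShortExact) :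
    (C.map (cornerFunctor j)).ShortExact :=
  ModuleCat.shortComplex_shortExact _
    (Corner.map_exact j ((ShortComplex.ShortExact.moduleCat_exact_iff_function_exact C).1 hC.exact))
    (Corner.map_injective j hC.moduleCat_injective_f)
    (Corner.map_surjective j hC.moduleCat_surjective_g)

/-- This lets a right adjoint of a corner functor preserve injectives; the companion for
epimorphisms lets a left adjoint preserve projectives. -/
instance : (cornerFunctor j).PreservesMonomorphisms where
  preserves f _ := (ModuleCat.mono_iff_injective _).2
    (Corner.map_injective j ((ModuleCat.mono_iff_injective f).1 inferInstance))

instance : (cornerFunctor j).PreservesEpimorphisms where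
  preserves f _ := (ModuleCat.epi_iff_surjective _).2
    (Corner.map_surjective j ((ModuleCat.epi_iff_surjective f).1 inferInstance))

end Corner

/-! ### Modules over a triangular matrix ring -/

namespace TriangularRing

variable {A B U : Type u} [Ring A] [Ring B] [AddCommGroup U] [Module B U]
    [Module Aᵐᵒᵖ U] [SMulCommClass B Aᵐᵒᵖ U]

variable (A B U) in
/-- The projection to `A`. -/
def toA : TriangularRing A B U →+* A where
  toFun := a
  map_one' := rfl
  map_mul' _ _ := rfl
  map_zero' := rfl
  map_add' _ _ := rfl

variable (A B U) in
/-- The projection to `B`. -/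
def toB : TriangularRing A B U →+* B where
  toFun := b
  map_one' := rfl
  map_mul' _ _ := rfl
  map_zero' := rfl
  map_add' _ _ := rfl

variable (A B U) in
/-- The inclusion of `A`, which is not unital. -/
def ofA : A →ₙ+* TriangularRing A B U where
  toFun a := ⟨a, 0, 0⟩
  map_mul' _ _ := by ext <;> simp
  map_zero' := rfl
  map_add' _ _ := by ext <;> simp

variable (A B U) in
/-- The inclusion of `B`, which is not unital. -/
def ofB : B →ₙ+* TriangularRing A B U where
  toFun b := ⟨0, 0, b⟩
  map_mul' _ _ := by ext <;> simp
  map_zero' := rfl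
  map_add' _ _ := by ext <;> simp

variable (A B) in
/-- The inclusion of `U`. -/
def ofU : U →+ TriangularRing A B U where
  toFun u := ⟨0, u, 0⟩
  map_zero' := rfl
  map_add' _ _ := by ext <;> simp

@[simp] theorem ofA_a (x : A) : (ofA A B U x).a = x := rfl
@[simp] theorem ofA_u (x : A) : (ofA A B U x).u = 0 := rfl
@[simp] theorem ofA_b (x : A) : (ofA A B U x).b = 0 := rfl
@[simp] theorem ofB_a (x : B) : (ofB A B U x).a = 0 := rfl
@[simp] theorem ofB_u (x : B) : (ofB A B U x).u = 0 := rfl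
@[simp] theorem ofB_b (x : B) : (ofB A B U x).b = x := rfl
@[simp] theorem ofU_a (x : U) : (ofU A B x).a = 0 := rfl
@[simp] theorem ofU_u (x : U) : (ofU A B x).u = x := rfl
@[simp] theorem ofU_b (x : U) : (ofU A B x).b = 0 := rfl
@[simp] theorem toB_apply (t : TriangularRing A B U) : toB A B U t = t.b := rfl

theorem ofA_one_add_ofB_one : ofA A B U 1 + ofB A B U 1 = 1 := by ext <;> simp

/-- The triangular shape in formulas: this identity makes the first component a quotient module, and
the next makes the second component a submodule. -/
theorem ofA_one_mul (t : TriangularRing A B U) : ofA A B U 1 * t = ofA A B U t.a := by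
  ext <;> simp

theorem mul_ofB_one (t : TriangularRing A B U) : t * ofB A B U 1 = ofB A B U t.b := by
  ext <;> simp

theorem ofB_one_mul (t : TriangularRing A B U) :
    ofB A B U 1 * t = ofU A B t.u + ofB A B U t.b := by
  ext <;> simp

variable (A B U) in
/-- An `A`-module `M` as the module `(M, 0)`. -/
noncomputable abbrev functorA : ModuleCat.{u} A ⥤ ModuleCat.{u} (TriangularRing A B U) :=
  ModuleCat.restrictScalars (toA A B U)

variable (A B U) in
/-- A `B`-module `N` as the module `(0, N)`. -/
noncomputable abbrev functorB : ModuleCat.{u} B ⥤ ModuleCat.{u} (TriangularRing A B U) :=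
  ModuleCat.restrictScalars (toB A B U)

variable (A B U) in
/-- The first component of a module. -/
abbrev cornerA : ModuleCat.{u} (TriangularRing A B U) ⥤ ModuleCat.{u} A :=
  cornerFunctor (ofA A B U)

variable (A B U) in
/-- The second component of a module. -/
abbrev cornerB : ModuleCat.{u} (TriangularRing A B U) ⥤ ModuleCat.{u} B :=
  cornerFunctor (ofB A B U)

section

variable (X : ModuleCat.{u} (TriangularRing A B U))

/-- The projection of a module to its first component. -/
noncomputable def toFirst : X →ₗ[TriangularRing A B U] (functorA A B U).obj ((cornerA A B U).obj X) where
  toFun x := ⟨ofA A B U 1 • x, Corner.smul_mem _ 1 x⟩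
  map_add' x y := Subtype.ext (smul_add _ _ _)
  map_smul' t x := Subtype.ext <| by
    change ofA A B U 1 • t • x = ofA A B U t.a • ofA A B U 1 • x
    rw [smul_smul, smul_smul, ofA_one_mul, ← map_mul, mul_one]

/-- The inclusion of the second component of a module. -/
noncomputable def ofSecond : (functorB A B U).obj ((cornerB A B U).obj X) →ₗ[TriangularRing A B U] X where
  toFun := fun x : Corner (ofB A B U) X => (x : X)
  map_add' _ _ := rfl
  map_smul' t := fun x : Corner (ofB A B U) X => by
    change ofB A B U t.b • (x : X) = t • (x : X)
    rw [← mul_ofB_one, mul_smul]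
    exact congrArg (t • ·) x.2

theorem ofSecond_injective : Function.Injective (ofSecond X) := Subtype.val_injective

theorem toFirst_surjective : Function.Surjective (toFirst X) :=
  fun x => ⟨x.1, Subtype.ext x.2⟩

theorem exact_ofSecond_toFirst : Function.Exact (ofSecond X) (toFirst X) := by
  intro x
  constructor
  · intro hx
    have h₀ : ofA A B U 1 • x = 0 := congrArg Subtype.val hx
    refine ⟨(⟨x, ?_⟩ : Corner (ofB A B U) X), rfl⟩
    change ofB A B U 1 • x = x
    conv_rhs => rw [← one_smul (TriangularRing A B U) x, ← ofA_one_add_ofB_one, add_smul, h₀,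
      zero_add]
  · rintro ⟨y, rfl⟩
    refine Subtype.ext ?_
    have hy : ofB A B U 1 • ofSecond X y = ofSecond X y :=
      Subtype.property (p := fun x : X => ofB A B U 1 • x = x) y
    change ofA A B U 1 • ofSecond X y = 0
    rw [← hy]
    rw [smul_smul, show ofA A B U 1 * ofB A B U 1 = 0 by ext <;> simp, zero_smul]

/-- The short exact sequence `0 → (0, X₂) → X → (X₁, 0) → 0`. -/
theorem shortExact_ofSecond_toFirst :
    (ShortComplex.mk (ModuleCat.ofHom (ofSecond X)) (ModuleCat.ofHom (toFirst X))
      (by ext x; exact (exact_ofSecond_toFirst X).apply_apply_eq_zero x)).ShortExact :=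
  ModuleCat.shortExact_ofHom (ofSecond_injective X) (exact_ofSecond_toFirst X)
    (toFirst_surjective X)

end

/-- The first component of `(M, 0)` is `M`. -/
noncomputable def cornerAIso (M : ModuleCat.{u} A) : (cornerA A B U).obj ((functorA A B U).obj M) ≅ M :=
  LinearEquiv.toModuleIso <|
    { toFun := fun x : Corner (ofA A B U) ((functorA A B U).obj M) => x.1
      map_add' _ _ := rfl
      map_smul' _ _ := rfl
      invFun := fun x : M => (⟨x, one_smul A x⟩ : Corner (ofA A B U) ((functorA A B U).obj M))
      left_inv _ := rfl
      right_inv _ := rfl }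

/-- The second component of `(0, N)` is `N`. -/
noncomputable def cornerBIso (N : ModuleCat.{u} B) : (cornerB A B U).obj ((functorB A B U).obj N) ≅ N :=
  LinearEquiv.toModuleIso <|
    { toFun := fun x : Corner (ofB A B U) ((functorB A B U).obj N) => x.1
      map_add' _ _ := rfl
      map_smul' _ _ := rfl
      invFun := fun x : N => (⟨x, one_smul B x⟩ : Corner (ofB A B U) ((functorB A B U).obj N))
      left_inv _ := rfl
      right_inv _ := rfl }

variable (A B U) in
/-- `X ↦ X₁` is left adjoint to `M ↦ (M, 0)`. -/
noncomputable def adjunctionA : cornerA A B U ⊣ functorA A B U :=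
  Adjunction.mkOfUnitCounit
    { unit := { app X := (ModuleCat.ofHom (toFirst X) :)
                naturality X Y f := by
                  ext x
                  exact Subtype.ext (f.hom.map_smul _ x).symm }
      counit := { app M := (cornerAIso M).hom
                  naturality _ _ _ := rfl }
      left_triangle := by
        ext X x
        exact Subtype.ext (Subtype.property (p := fun x : X => ofA A B U 1 • x = x) x)
      right_triangle := by
        ext M x
        exact one_smul (M := A) (α := M) x }

variable (A B U) in
/-- `N ↦ (0, N)` is left adjoint to `X ↦ X₂`. -/
noncomputable def adjunctionB : functorB A B U ⊣ cornerB A B U :=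
  Adjunction.mkOfUnitCounit
    { unit := { app N := (cornerBIso N).inv
                naturality _ _ _ := rfl }
      counit := { app X := (ModuleCat.ofHom (ofSecond X) :)
                  naturality _ _ _ := rfl }
      left_triangle := rfl
      right_triangle := rfl }

theorem functorA_shortExact (C : ShortComplex (ModuleCat.{u} A)) (hC : C.ShortExact) :
    (C.map (functorA A B U)).ShortExact :=
  ModuleCat.shortComplex_shortExact _
    ((ShortComplex.ShortExact.moduleCat_exact_iff_function_exact C).1 hC.exact)
    hC.moduleCat_injective_f hC.moduleCat_surjective_g

theorem functorB_shortExact (C : ShortComplex (ModuleCat.{u} B)) (hC : C.ShortExact) :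
    (C.map (functorB A B U)).ShortExact :=
  ModuleCat.shortComplex_shortExact _
    ((ShortComplex.ShortExact.moduleCat_exact_iff_function_exact C).1 hC.exact)
    hC.moduleCat_injective_f hC.moduleCat_surjective_g

/-- This and the next three facts are formal: right adjoints of functors preserving monomorphisms
preserve injectives, and left adjoints of functors preserving epimorphisms preserve projectives. -/
theorem functorA_injective (M : ModuleCat.{u} A) (hM : Injective M) :
    Injective ((functorA A B U).obj M) :=
  Injective.injective_of_adjoint (adjunctionA A B U) M

theorem cornerA_projective (X : ModuleCat.{u} (TriangularRing A B U)) (hX : Projective X) :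
    Projective ((cornerA A B U).obj X) :=
  (adjunctionA A B U).map_projective X hX

theorem cornerB_injective (X : ModuleCat.{u} (TriangularRing A B U)) (hX : Injective X) :
    Injective ((cornerB A B U).obj X) :=
  Injective.injective_of_adjoint (adjunctionB A B U) X

/-- For reflection, a lifting problem over B is solved over T, and the solution is carried back by
taking second components. -/
theorem functorB_projective_iff (N : ModuleCat.{u} B) :
    Projective ((functorB A B U).obj N) ↔ Projective N := by
  refine ⟨fun h => ⟨fun {E Y} f e he => ?_⟩, (adjunctionB A B U).map_projective N⟩
  obtain ⟨g, hg⟩ := h.factors ((functorB A B U).map f) ((functorB A B U).map e)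
  refine ⟨(cornerBIso N).inv ≫ (cornerB A B U).map g ≫ (cornerBIso E).hom, ?_⟩
  ext x
  exact LinearMap.congr_fun (congrArg ModuleCat.Hom.hom hg) x

/-- A projective `A`-module is a retract of the first component of a projective module. -/
theorem exists_retract_cornerA (F : ModuleCat.{u} A) (hF : Projective F) :
    ∃ P : ModuleCat.{u} (TriangularRing A B U), Projective P ∧
      Nonempty (Retract F ((cornerA A B U).obj P)) := by
  obtain ⟨p⟩ := EnoughProjectives.presentation ((functorA A B U).obj F)
  have := p.epi
  -- A projective cover of (F, 0), not necessarily minimal, has first component mapping onto `F`;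
  -- this surjection splits.
  refine ⟨p.p, p.projective, ⟨Projective.factorThru (𝟙 F) ((cornerA A B U).map p.f ≫
    (cornerAIso F).hom), (cornerA A B U).map p.f ≫ (cornerAIso F).hom, ?_⟩⟩
  simp

end TriangularRing

/-! ### The tensor-hom adjunction -/

section Hom

variable (A B U J : Type u) [Ring A] [Ring B] [AddCommGroup U] [Module B U]
    [Module Aᵐᵒᵖ U] [AddCommGroup J] [Module B J]

/-- The `A`-module `Hom_B(U, J)`. -/
def BimodHom : Type u := U →ₗ[B] J

namespace BimodHom

instance : AddCommGroup (BimodHom B U J) := inferInstanceAs (AddCommGroup (U →ₗ[B] J))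

instance : FunLike (BimodHom B U J) U J := inferInstanceAs (FunLike (U →ₗ[B] J) U J)

instance : LinearMapClass (BimodHom B U J) B U J :=
  inferInstanceAs (LinearMapClass (U →ₗ[B] J) B U J)

variable {B U J}

@[ext] theorem ext {f g : BimodHom B U J} (h : ∀ x, f x = g x) : f = g := DFunLike.ext f g h

@[simp] theorem zero_apply (x : U) : (0 : BimodHom B U J) x = 0 := rfl
@[simp] theorem add_apply (f g : BimodHom B U J) (x : U) : (f + g) x = f x + g x := rfl

variable [SMulCommClass B Aᵐᵒᵖ U]

variable (B U) in
/-- Right multiplication on `U` by an element of `A`. -/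
def rightMul (a : A) : U →ₗ[B] U where
  toFun x := MulOpposite.op a • x
  map_add' := smul_add _
  map_smul' b x := (smul_comm b (MulOpposite.op a) x).symm

instance : SMul A (BimodHom B U J) :=
  ⟨fun a f => LinearMap.comp (show U →ₗ[B] J from f) (rightMul A B U a)⟩

variable {A}

@[simp] theorem smul_apply (a : A) (f : BimodHom B U J) (x : U) :
    (a • f) x = f (MulOpposite.op a • x) := rfl

instance : Module A (BimodHom B U J) where
  one_smul f := by ext x; simp
  mul_smul a b f := by ext x; simp [mul_smul]
  smul_zero a := by ext x; simp
  smul_add a f g := by ext x; simp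
  add_smul a b f := by ext x; simp [add_smul]
  zero_smul f := by ext x; simp

end BimodHom

namespace BimodTensor

variable {A B U J}
variable {M N : Type u} [AddCommGroup M] [Module A M] [AddCommGroup N] [Module A N]

variable (A B U) in
/-- The class of `x ⊗ m`. -/
def tmul (x : U) (m : M) : BimodTensor A B U M := Submodule.Quotient.mk (x ⊗ₜ[ℤ] m)

theorem tmul_add (x : U) (m m' : M) :
    tmul A B U x (m + m') = tmul A B U x m + tmul A B U x m' :=
  congrArg Submodule.Quotient.mk (TensorProduct.tmul_add x m m')

theorem add_tmul (x x' : U) (m : M) :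
    tmul A B U (x + x') m = tmul A B U x m + tmul A B U x' m :=
  congrArg Submodule.Quotient.mk (TensorProduct.add_tmul x x' m)

theorem smul_tmul (b : B) (x : U) (m : M) :
    tmul A B U (b • x) m = b • tmul A B U x m := rfl

theorem op_smul_tmul (a : A) (x : U) (m : M) :
    tmul A B U (MulOpposite.op a • x) m = tmul A B U x (a • m) :=
  (Submodule.Quotient.eq _).2 (Submodule.subset_span ⟨x, a, m, rfl⟩)

theorem hom_ext {f g : BimodTensor A B U M →ₗ[B] J}
    (h : ∀ x m, f (tmul A B U x m) = g (tmul A B U x m)) : f = g := by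
  refine Submodule.linearMap_qext _ (TensorProduct.AlgebraTensorModule.ext h)

/-- The map `x ↦ x ⊗ m`. -/
def mkLeft (m : M) : U →ₗ[B] BimodTensor A B U M where
  toFun x := tmul A B U x m
  map_add' x y := add_tmul x y m
  map_smul' b x := smul_tmul b x m

variable [SMulCommClass B Aᵐᵒᵖ U]

/-- The map `U ⊗_A M → J` which corresponds to a map `M → Hom_B(U, J)`. -/
def lift (g : M →ₗ[A] BimodHom B U J) : BimodTensor A B U M →ₗ[B] J :=
  Submodule.liftQ _ (TensorProduct.AlgebraTensorModule.lift
    { toFun x := AddMonoidHom.toIntLinearMap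
        { toFun m := g m x
          map_zero' := by simp
          map_add' := by simp }
      map_add' x y := by ext m; simp
      map_smul' b x := by ext m; simp }) <| by
    refine Submodule.span_le.2 ?_
    rintro _ ⟨w, a, m, rfl⟩
    simp

/-- The map `M → Hom_B(U, J)` which corresponds to a map `U ⊗_A M → J`. -/
def curry (θ : BimodTensor A B U M →ₗ[B] J) : M →ₗ[A] BimodHom B U J where
  toFun m := θ ∘ₗ mkLeft m
  map_add' m m' := by
    refine BimodHom.ext fun x => ?_
    change θ (tmul A B U x (m + m')) = θ (tmul A B U x m) + θ (tmul A B U x m')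
    rw [tmul_add, map_add]
  map_smul' a m := by
    refine BimodHom.ext fun x => ?_
    change θ (tmul A B U x (a • m)) = θ (tmul A B U (MulOpposite.op a • x) m)
    rw [op_smul_tmul]

end BimodTensor

end Hom

/-! ### What compatibility says about injective dimension -/

/-- Both maps factor through the quotient of `M` by the kernel of `f`, which embeds in `N`. -/
theorem Module.Injective.exists_comp_eq {R : Type u} [Ring R] {M N J : Type u} [AddCommGroup M]
    [Module R M] [AddCommGroup N] [Module R N] [AddCommGroup J] [Module R J]
    (hJ : Module.Injective R J) (f : M →ₗ[R] N) (g : M →ₗ[R] J)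
    (h : LinearMap.ker f ≤ LinearMap.ker g) : ∃ g' : N →ₗ[R] J, g' ∘ₗ f = g := by
  obtain ⟨g', hg'⟩ := hJ.out ((LinearMap.ker f).liftQ f le_rfl)
    (LinearMap.ker_eq_bot.1 (Submodule.ker_liftQ_eq_bot _ _ _ le_rfl))
    ((LinearMap.ker f).liftQ g h)
  exact ⟨g', LinearMap.ext fun x => hg' (Submodule.Quotient.mk x)⟩

/-- Condition (a) keeps U ⊗_A S exact, Hom_B(-, J) preserves this, and adjunction identifies the
result with Hom_A(S, Hom_B(U, J)). -/
theorem IsCompatibleBimodule.hasInjectiveDimensionLE_bimodHom {A B U : Type u} [Ring A] [Ring B]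
    [AddCommGroup U] [Module B U] [Module Aᵐᵒᵖ U] [SMulCommClass B Aᵐᵒᵖ U]
    (hU : IsCompatibleBimodule A B U) {n : ℕ}
    (hA : ∀ I : ModuleCat.{u} A, Injective I → HasProjectiveDimensionLE I n)
    (J : Type u) [AddCommGroup J] [Module B J] (hJ : Module.Injective B J) :
    HasInjectiveDimensionLE (ModuleCat.of A (BimodHom B U J)) n := by
  refine AcyclicProjective.hasInjectiveDimensionLE hA _ fun S n g => ⟨fun hg => ?_, ?_⟩
  · have hex := hU.tensor_exact _ _ S.isProjAddExactSeq n
    let θ := BimodTensor.lift (show S.P (n + 1) →ₗ[A] BimodHom B U J from g)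
    have hθ : θ ∘ₗ bimodTensorMap A B U (S.d n) = 0 := by
      refine BimodTensor.hom_ext fun x m => ?_
      exact congrArg (fun f : BimodHom B U J => f x) (LinearMap.congr_fun hg m)
    obtain ⟨θ', hθ'⟩ := hJ.exists_comp_eq (bimodTensorMap A B U (S.d (n + 1))) θ <| by
      intro x hx
      obtain ⟨y, rfl⟩ := (hex x).1 hx
      exact LinearMap.congr_fun hθ y
    refine ⟨BimodTensor.curry θ', LinearMap.ext fun m => BimodHom.ext fun x => ?_⟩
    exact LinearMap.congr_fun hθ' (BimodTensor.tmul A B U x m)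
  · rintro ⟨g', rfl⟩
    refine LinearMap.ext fun x => ?_
    change g' (S.d (n + 1) (S.d n x)) = 0
    rw [(S.isProjAddExactSeq.exact n).apply_apply_eq_zero, map_zero]

/-- The bound `n` comes from the syzygy criterion; finiteness of `m` serves only to verify the
premise of condition (b). -/
theorem IsCompatibleBimodule.hasInjectiveDimensionLE_bimodTensor {A B U : Type u} [Ring A]
    [Ring B] [AddCommGroup U] [Module B U] [Module Aᵐᵒᵖ U]
    (hU : IsCompatibleBimodule A B U) {n m : ℕ}
    (hB : ∀ I : ModuleCat.{u} B, Injective I → HasProjectiveDimensionLE I n)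
    (hB' : ∀ P : ModuleCat.{u} B, Projective P → HasInjectiveDimensionLE P m)
    (Q : Type u) [AddCommGroup Q] [Module A Q] [Module.Projective A Q] :
    HasInjectiveDimensionLE (ModuleCat.of B (BimodTensor A B U Q)) n := by
  refine AcyclicProjective.hasInjectiveDimensionLE hB _ fun S =>
    hU.hom_exact _ _ S.isProjAddExactSeq (fun Y _ _ hY => ?_) Q (isAdd_of_projective A Q)
  have := hY.projective
  exact S.isHomExact (ModuleCat.of B Y) (hB' _ inferInstance)

namespace TriangularRing

/-! ### Coinduced modules -/

section Coind

variable (A B U I J : Type u) [Ring A] [Ring B] [AddCommGroup U] [Module B U]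
    [Module Aᵐᵒᵖ U] [SMulCommClass B Aᵐᵒᵖ U] [AddCommGroup I] [Module A I] [AddCommGroup J]
    [Module B J]

/-- The module `(Hom_B(U, J) ⊕ I, J)`. -/
@[ext]
structure Coind : Type u where
  hom : BimodHom B U J
  fst : I
  snd : J

namespace Coind

variable {B U I J}

/-- The underlying triple. -/
def equivProd : Coind B U I J ≃ BimodHom B U J × I × J where
  toFun x := ⟨x.hom, x.fst, x.snd⟩
  invFun x := ⟨x.1, x.2.1, x.2.2⟩
  left_inv _ := rfl
  right_inv _ := rfl

instance : AddCommGroup (Coind B U I J) := equivProd.addCommGroup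

@[simp] theorem add_hom (x y : Coind B U I J) : (x + y).hom = x.hom + y.hom := rfl
@[simp] theorem add_fst (x y : Coind B U I J) : (x + y).fst = x.fst + y.fst := rfl
@[simp] theorem add_snd (x y : Coind B U I J) : (x + y).snd = x.snd + y.snd := rfl
@[simp] theorem zero_hom : (0 : Coind B U I J).hom = 0 := rfl
@[simp] theorem zero_fst : (0 : Coind B U I J).fst = 0 := rfl
@[simp] theorem zero_snd : (0 : Coind B U I J).snd = 0 := rfl

variable {A}

instance : SMul (TriangularRing A B U) (Coind B U I J) :=
  ⟨fun t x => ⟨t.a • x.hom, t.a • x.fst, x.hom t.u + t.b • x.snd⟩⟩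

@[simp] theorem smul_hom (t : TriangularRing A B U) (x : Coind B U I J) :
    (t • x).hom = t.a • x.hom := rfl
@[simp] theorem smul_fst (t : TriangularRing A B U) (x : Coind B U I J) :
    (t • x).fst = t.a • x.fst := rfl
@[simp] theorem smul_snd (t : TriangularRing A B U) (x : Coind B U I J) :
    (t • x).snd = x.hom t.u + t.b • x.snd := rfl

instance : Module (TriangularRing A B U) (Coind B U I J) where
  one_smul x := by ext <;> simp
  mul_smul s t x := by ext <;> simp [mul_smul, add_assoc]
  smul_zero t := by ext <;> simp
  smul_add t x y := by ext <;> simp; abel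
  add_smul s t x := by ext <;> simp [add_smul]; abel
  zero_smul x := by ext <;> simp

variable {X : Type u} [AddCommGroup X] [Module (TriangularRing A B U) X]

theorem ofU_smul_mem (x : X) (w : U) : ofU A B w • x ∈ Corner (ofB A B U) X := by
  change ofB A B U 1 • ofU A B w • x = ofU A B w • x
  rw [smul_smul]
  congr 1
  ext <;> simp

variable (A B U X) in
/-- The structure map `X₁ → Hom_B(U, X₂)` of a module, extended by zero to `X`. -/
def structureMap : X →+ BimodHom B U (Corner (ofB A B U) X) where
  toFun x :=
    { toFun w := ⟨ofU A B w • x, ofU_smul_mem x w⟩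
      map_add' w w' := Subtype.ext (by simp [add_smul])
      map_smul' b w := Subtype.ext <| by
        change ofU A B (b • w) • x = ofB A B U b • ofU A B w • x
        rw [smul_smul]
        congr 1
        ext <;> simp }
  map_zero' := BimodHom.ext fun w => Subtype.ext (smul_zero _)
  map_add' x y := BimodHom.ext fun w => Subtype.ext (smul_add _ _ _)

@[simp] theorem coe_structureMap_apply (x : X) (w : U) :
    (structureMap A B U X x w : X) = ofU A B w • x := rfl

theorem structureMap_smul (t : TriangularRing A B U) (x : X) :
    structureMap A B U X (t • x) = t.a • structureMap A B U X x := by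
  refine BimodHom.ext fun w => Subtype.ext ?_
  simp only [coe_structureMap_apply, BimodHom.smul_apply, smul_smul]
  congr 1
  ext <;> simp

/-- The map to a coinduced module which corresponds to maps of the components. -/
def lift (f : Corner (ofA A B U) X →ₗ[A] I) (g : Corner (ofB A B U) X →ₗ[B] J) :
    X →ₗ[TriangularRing A B U] Coind B U I J where
  toFun x := ⟨LinearMap.comp g (show U →ₗ[B] _ from structureMap A B U X x),
    f ⟨ofA A B U 1 • x, Corner.smul_mem _ 1 x⟩, g ⟨ofB A B U 1 • x, Corner.smul_mem _ 1 x⟩⟩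
  map_add' x y := by
    ext w
    · change g (structureMap A B U X (x + y) w) =
        g (structureMap A B U X x w) + g (structureMap A B U X y w)
      rw [map_add, BimodHom.add_apply, map_add]
    · rw [add_fst, ← map_add]
      exact congrArg f (Subtype.ext (smul_add _ _ _))
    · rw [add_snd, ← map_add]
      exact congrArg g (Subtype.ext (smul_add _ _ _))
  map_smul' t x := by
    ext w
    · change g (structureMap A B U X (t • x) w) = _
      rw [structureMap_smul]
      rfl
    · rw [RingHom.id_apply, smul_fst, ← map_smul]
      refine congrArg f (Subtype.ext ?_)
      change ofA A B U 1 • t • x = ofA A B U t.a • ofA A B U 1 • x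
      rw [smul_smul, smul_smul, ofA_one_mul, ← map_mul, mul_one]
    · change _ = g (structureMap A B U X x t.u) + t.b • g _
      rw [← map_smul, ← map_add]
      refine congrArg g (Subtype.ext ?_)
      change ofB A B U 1 • t • x = ofU A B t.u • x + ofB A B U t.b • ofB A B U 1 • x
      rw [smul_smul, smul_smul, ofB_one_mul, ← map_mul, mul_one, add_smul]

/-- The two idempotents sum to one, so the coordinates `fst` and `snd` already detect every element.
-/
theorem lift_injective {f : Corner (ofA A B U) X →ₗ[A] I} {g : Corner (ofB A B U) X →ₗ[B] J}
    (hf : Function.Injective f) (hg : Function.Injective g) : Function.Injective (lift f g) := by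
  refine (injective_iff_map_eq_zero _).2 fun x hx => ?_
  have h₁ := congrArg Subtype.val ((injective_iff_map_eq_zero f).1 hf _ (congrArg fst hx))
  have h₂ := congrArg Subtype.val ((injective_iff_map_eq_zero g).1 hg _ (congrArg snd hx))
  rw [← one_smul (TriangularRing A B U) x, ← ofA_one_add_ofB_one, add_smul]
  exact (congrArg₂ (· + ·) h₁ h₂).trans (add_zero 0)

variable (A) in
-- Maps from X to the coinduced module are pairs of maps X₁ → I and X₂ → J; each extends separately
-- because corners preserve injections.
theorem injective (hI : Module.Injective A I) (hJ : Module.Injective B J) :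
    Module.Injective (TriangularRing A B U) (Coind B U I J) where
  out X Y _ _ _ _ i hi φ := by
    obtain ⟨f, hf⟩ := hI.out (Corner.map (ofA A B U) i) (Corner.map_injective _ hi)
      { toFun x := (φ x.1).fst
        map_add' x y := by simp
        map_smul' a x := by simp }
    obtain ⟨g, hg⟩ := hJ.out (Corner.map (ofB A B U) i) (Corner.map_injective _ hi)
      { toFun x := (φ x.1).snd
        map_add' x y := by simp
        map_smul' a x := by simp }
    refine ⟨lift f g, fun x => ?_⟩
    ext w
    -- Multiplication by `ofU A B w` moves the value at `w` of the `hom` coordinate into `snd`, so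
    -- `g` determines it.
    · refine (congrArg g (Subtype.ext (map_smul i _ x).symm)).trans
        ((hg ⟨ofU A B w • x, ofU_smul_mem x w⟩).trans ?_)
      simp
    · refine (congrArg f (Subtype.ext (map_smul i _ x).symm)).trans
        ((hf ⟨ofA A B U 1 • x, Corner.smul_mem _ 1 x⟩).trans ?_)
      simp
    · refine (congrArg g (Subtype.ext (map_smul i _ x).symm)).trans
        ((hg ⟨ofB A B U 1 • x, Corner.smul_mem _ 1 x⟩).trans ?_)
      simp

variable (A B U I J)

/-- The first component of a coinduced module. -/
def cornerAEquiv : Corner (ofA A B U) (Coind B U I J) ≃ₗ[A] BimodHom B U J × I where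
  toFun x := ⟨x.1.hom, x.1.fst⟩
  map_add' _ _ := rfl
  map_smul' _ _ := rfl
  invFun y := ⟨⟨y.1, y.2, 0⟩, by
    change ofA A B U 1 • (⟨y.1, y.2, 0⟩ : Coind B U I J) = _
    ext <;> simp⟩
  left_inv x := by
    have h : ofA A B U 1 • x.1 = x.1 := x.2
    have h' : x.1.snd = 0 := by rw [← h]; simp
    refine Subtype.ext ?_
    ext
    · rfl
    · rfl
    · exact h'.symm
  right_inv _ := rfl

/-- The second component of a coinduced module. -/
def cornerBEquiv : Corner (ofB A B U) (Coind B U I J) ≃ₗ[B] J where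
  toFun x := x.1.snd
  map_add' _ _ := rfl
  map_smul' b x := by simp
  invFun y := ⟨⟨0, 0, y⟩, by
    change ofB A B U 1 • (⟨0, 0, y⟩ : Coind B U I J) = _
    ext <;> simp⟩
  left_inv x := by
    have h : ofB A B U 1 • x.1 = x.1 := x.2
    have h₁ : x.1.hom = 0 := by rw [← h]; simp
    have h₂ : x.1.fst = 0 := by rw [← h]; simp
    refine Subtype.ext ?_
    ext w
    · exact (DFunLike.congr_fun h₁ w).symm
    · exact h₂.symm
    · rfl
  right_inv _ := rfl

end Coind

end Coind

end TriangularRing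

theorem ModuleCat.hasInjectiveDimensionLE_prod {R M N : Type u} [Ring R] [AddCommGroup M]
    [Module R M] [AddCommGroup N] [Module R N] {n : ℕ}
    (hM : HasInjectiveDimensionLE (ModuleCat.of R M) n)
    (hN : HasInjectiveDimensionLE (ModuleCat.of R N) n) :
    HasInjectiveDimensionLE (ModuleCat.of R (M × N)) n :=
  (ModuleCat.shortExact_ofHom (K := ModuleCat.of R M) (M := ModuleCat.of R (M × N))
    (N := ModuleCat.of R N) (f := LinearMap.inl R M N) (g := LinearMap.snd R M N)
    LinearMap.inl_injective Function.Exact.inl_snd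
    LinearMap.snd_surjective).hasInjectiveDimensionLT_X₂ (n + 1) hM hN

/-- A retraction in terms of linear maps. -/
def ModuleCat.retractOfLinear {R M N : Type u} [Ring R] [AddCommGroup M]
    [Module R M] [AddCommGroup N] [Module R N] (i : M →ₗ[R] N) (r : N →ₗ[R] M)
    (h : r ∘ₗ i = LinearMap.id) : Retract (ModuleCat.of R M) (ModuleCat.of R N) where
  i := ModuleCat.ofHom i
  r := ModuleCat.ofHom r
  retract := by rw [← ModuleCat.ofHom_comp, h]; rfl

namespace TriangularRing

variable {A B U : Type u} [Ring A] [Ring B] [AddCommGroup U] [Module B U]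
    [Module Aᵐᵒᵖ U] [SMulCommClass B Aᵐᵒᵖ U]

/-! ### Second components of projective modules -/

section Free

variable (A B U) (X : Type u) [AddCommGroup X] [Module (TriangularRing A B U) X] (I : Type u)

/-- The structure map `X₁ → Hom_B(U, X₂)`. -/
def structureHom : Corner (ofA A B U) X →ₗ[A] BimodHom B U (Corner (ofB A B U) X) where
  toFun x := Coind.structureMap A B U X x
  map_add' x y := map_add (Coind.structureMap A B U X) x.1 y.1
  map_smul' a x := Coind.structureMap_smul (ofA A B U a) x.1

/-- The basis elements of the first component of a free module. -/
noncomputable def freeFst (i : I) : Corner (ofA A B U) (I →₀ TriangularRing A B U) :=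
  ⟨ofA A B U 1 • Finsupp.single i 1, Corner.smul_mem _ 1 _⟩

/-- The basis elements of the projective part of the second component of a free module. -/
noncomputable def freeSnd (i : I) : Corner (ofB A B U) (I →₀ TriangularRing A B U) :=
  ⟨ofB A B U 1 • Finsupp.single i 1, Corner.smul_mem _ 1 _⟩

/-- The projection of a free module `X` to `U ⊗_A X₁`. -/
noncomputable def freeToTensor : (I →₀ TriangularRing A B U) →+
    BimodTensor A B U (Corner (ofA A B U) (I →₀ TriangularRing A B U)) :=
  Finsupp.liftAddHom fun i =>
    { toFun t := BimodTensor.mkLeft (freeFst A B U I i) t.u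
      map_zero' := map_zero _
      map_add' s t := map_add _ s.u t.u }

/-- The projection of the second component of a free module to its projective part. -/
noncomputable def freeToFinsupp : (I →₀ TriangularRing A B U) →+ (I →₀ B) :=
  Finsupp.mapRange.addMonoidHom (toB A B U : TriangularRing A B U →+ B)

/-- The second component of a free module is a retract of `(U ⊗_A X₁) ⊕ B^(I)`. -/
theorem retract_cornerB_free :
    Nonempty (Retract ((cornerB A B U).obj (ModuleCat.of _ (I →₀ TriangularRing A B U)))
      (ModuleCat.of B (BimodTensor A B U (Corner (ofA A B U) (I →₀ TriangularRing A B U)) ×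
        (I →₀ B)))) := by
  let s₁ : Corner (ofB A B U) (I →₀ TriangularRing A B U) →ₗ[B]
      BimodTensor A B U (Corner (ofA A B U) (I →₀ TriangularRing A B U)) :=
    { toFun x := freeToTensor A B U I x
      map_add' x y := map_add (freeToTensor A B U I) x.1 y.1
      map_smul' b x := by
        suffices (freeToTensor A B U I).comp (DistribSMul.toAddMonoidHom _ (ofB A B U b)) =
          (DistribSMul.toAddMonoidHom _ b).comp (freeToTensor A B U I) from
          DFunLike.congr_fun this x.1
        refine Finsupp.addHom_ext fun i t => ?_
        change freeToTensor A B U I (ofB A B U b • Finsupp.single i t) =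
          b • freeToTensor A B U I (Finsupp.single i t)
        rw [Finsupp.smul_single, freeToTensor, Finsupp.liftAddHom_apply_single,
          Finsupp.liftAddHom_apply_single]
        have h : (ofB A B U b * t).u = b • t.u := by simp
        change BimodTensor.mkLeft _ (ofB A B U b * t).u = b • BimodTensor.mkLeft _ t.u
        rw [h, map_smul] }
  let s₂ : Corner (ofB A B U) (I →₀ TriangularRing A B U) →ₗ[B] (I →₀ B) :=
    { toFun x := freeToFinsupp A B U I x
      map_add' x y := map_add (freeToFinsupp A B U I) x.1 y.1
      map_smul' b x := by
        ext i
        simp [freeToFinsupp] }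
  let r₁ := BimodTensor.lift (structureHom A B U (I →₀ TriangularRing A B U))
  let r₂ : (I →₀ B) →ₗ[B] Corner (ofB A B U) (I →₀ TriangularRing A B U) :=
    Finsupp.linearCombination B (freeSnd A B U I)
  refine ⟨ModuleCat.retractOfLinear (s₁.prod s₂) (r₁.coprod r₂) (LinearMap.ext fun x => ?_)⟩
  -- The identity is proved on the whole free module, where generators suffice; on the corner the
  -- right-hand side is the identity. On a generator it is `ofB_one_mul`.
  have key : (AddSubgroup.subtype _).comp
      ((r₁.toAddMonoidHom.comp (freeToTensor A B U I)) +
        (r₂.toAddMonoidHom.comp (freeToFinsupp A B U I))) =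
      DistribSMul.toAddMonoidHom _ (ofB A B U 1) := by
    refine Finsupp.addHom_ext fun i t => ?_
    have h₁ : (r₁ (BimodTensor.mkLeft (freeFst A B U I i) t.u)).1 =
        ofU A B t.u • ofA A B U 1 • Finsupp.single i 1 := rfl
    have h₂ : (r₂ (Finsupp.single i t.b)).1 = ofB A B U t.b • ofB A B U 1 •
        Finsupp.single i 1 := by
      simp only [r₂, Finsupp.linearCombination_single]
      rfl
    have h : (r₁ (BimodTensor.mkLeft (freeFst A B U I i) t.u)).1 +
        (r₂ (Finsupp.single i t.b)).1 = ofB A B U 1 • Finsupp.single i t := by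
      rw [h₁, h₂, smul_smul, smul_smul, ← add_smul, Finsupp.smul_single, Finsupp.smul_single]
      congr 1
      ext <;> simp
    simpa [freeToTensor, freeToFinsupp] using h
  have h : ofB A B U 1 • x.1 = x.1 := x.2
  exact Subtype.ext ((DFunLike.congr_fun key x.1).trans h)

end Free

/-- The second component of a projective module has finite injective dimension. -/
theorem hasInjectiveDimensionLE_cornerB (hU : IsCompatibleBimodule A B U) {n : ℕ}
    (hB : ∀ I : ModuleCat.{u} B, Injective I → HasProjectiveDimensionLE I n)
    (hB' : ∀ P : ModuleCat.{u} B, Projective P → HasInjectiveDimensionLE P n)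
    (P : ModuleCat.{u} (TriangularRing A B U)) (hP : Projective P) :
    HasInjectiveDimensionLE ((cornerB A B U).obj P) n := by
  obtain ⟨I, i, r, h⟩ := isAdd_of_projective (TriangularRing A B U) P
  obtain ⟨h'⟩ := retract_cornerB_free A B U I
  have : Projective (ModuleCat.of A (Corner (ofA A B U) (I →₀ TriangularRing A B U))) :=
    cornerA_projective (ModuleCat.of _ (I →₀ TriangularRing A B U)) inferInstance
  have : Module.Projective A (Corner (ofA A B U) (I →₀ TriangularRing A B U)) :=
    (IsProjective.iff_projective _).2 this
  have := ModuleCat.hasInjectiveDimensionLE_prod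
    (hU.hasInjectiveDimensionLE_bimodTensor hB hB'
      (Corner (ofA A B U) (I →₀ TriangularRing A B U)))
    (hB' (ModuleCat.of B (I →₀ B)) inferInstance)
  have := h'.hasInjectiveDimensionLT (n + 1)
  exact ((ModuleCat.retractOfLinear i r h).map (cornerB A B U)).hasInjectiveDimensionLT (n + 1)

/-! ### Injective modules and the inclusion of B-modules -/

section

variable (hU : IsCompatibleBimodule A B U) {n : ℕ}
  (hA : ∀ I : ModuleCat.{u} A, Injective I → HasProjectiveDimensionLE I n)

include hU hA

theorem hasInjectiveDimensionLE_bimodHom_prod (I : ModuleCat.{u} A) (hI : Injective I)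
    (J : ModuleCat.{u} B) (hJ : Injective J) :
    HasInjectiveDimensionLE (ModuleCat.of A (BimodHom B U J × I)) n :=
  ModuleCat.hasInjectiveDimensionLE_prod
    (hU.hasInjectiveDimensionLE_bimodHom hA J ((Module.injective_iff_injective_object B J).2 hJ))
    (hasInjectiveDimensionLT_of_ge _ 1 _ (by lia))

/-- The module (0, J) is the kernel of the surjection from the injective (Hom_B(U, J), J) to
(Hom_B(U, J), 0). The latter has injective dimension at most `n`, and the kernel costs one more. -/
theorem hasInjectiveDimensionLE_functorB_of_injective (J : ModuleCat.{u} B) (hJ : Injective J) :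
    HasInjectiveDimensionLE ((functorB A B U).obj J) (n + 1) := by
  let C := ModuleCat.of (TriangularRing A B U) (Coind B U PUnit.{u + 1} J)
  have hI : Module.Injective A PUnit.{u + 1} := ⟨fun _ _ _ _ _ _ _ _ _ => ⟨0, fun _ => rfl⟩⟩
  have hC : Injective C := (Module.injective_iff_injective_object _ _).1
    (Coind.injective A hI ((Module.injective_iff_injective_object B J).2 hJ))
  have h₁ := hasInjectiveDimensionLE_bimodHom_prod hU hA (ModuleCat.of A PUnit.{u + 1})
    ((Module.injective_iff_injective_object _ _).1 hI) J hJ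
  have h₂ : HasInjectiveDimensionLE ((cornerA A B U).obj C) n :=
    hasInjectiveDimensionLT_of_iso
      (Coind.cornerAEquiv A B U PUnit.{u + 1} J).symm.toModuleIso (n + 1)
  have h₃ := hasInjectiveDimensionLE_obj (functorA A B U) functorA_shortExact (k := 0)
    (fun I hI => injective_iff_hasInjectiveDimensionLT_one.1 (functorA_injective I hI)) n _ h₂
  have h₄ := (shortExact_ofSecond_toFirst C).hasInjectiveDimensionLT_X₁ (n + 1) h₃
    (hasInjectiveDimensionLT_of_ge C 1 _ (by lia))
  have h₄' : HasInjectiveDimensionLT ((functorB A B U).obj ((cornerB A B U).obj C)) (n + 1 + 1) :=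
    h₄
  exact @hasInjectiveDimensionLT_of_iso _ _ _ _ _ ((functorB A B U).mapIso
    (Coind.cornerBEquiv A B U PUnit.{u + 1} J).toModuleIso) (n + 1 + 1) h₄'

/-- Injective hulls play no role: any embeddings of the components into injectives embed X in a
coinduced module, and X splits off. -/
theorem hasInjectiveDimensionLE_cornerA_of_injective (X : ModuleCat.{u} (TriangularRing A B U))
    (hX : Injective X) : HasInjectiveDimensionLE ((cornerA A B U).obj X) n := by
  obtain ⟨p⟩ := EnoughInjectives.presentation ((cornerA A B U).obj X)
  obtain ⟨q⟩ := EnoughInjectives.presentation ((cornerB A B U).obj X)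
  have := p.injective
  have := q.injective
  let C := ModuleCat.of (TriangularRing A B U) (Coind B U p.J q.J)
  let f : X ⟶ C := ModuleCat.ofHom (Coind.lift p.f.hom q.f.hom)
  have hf : Mono f := (ModuleCat.mono_iff_injective _).2 (Coind.lift_injective
    ((ModuleCat.mono_iff_injective _).1 p.mono) ((ModuleCat.mono_iff_injective _).1 q.mono))
  have h : Retract X C := ⟨f, Injective.factorThru (𝟙 X) f, Injective.comp_factorThru _ _⟩
  have h₁ := hasInjectiveDimensionLE_bimodHom_prod hU hA p.J inferInstance q.J inferInstance
  have h₂ : HasInjectiveDimensionLE ((cornerA A B U).obj C) n :=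
    hasInjectiveDimensionLT_of_iso (Coind.cornerAEquiv A B U p.J q.J).symm.toModuleIso (n + 1)
  exact (h.map (cornerA A B U)).hasInjectiveDimensionLT (n + 1)

end

/-! ### Gorenstein regularity -/

theorem isLeftGorensteinRegular_components (hU : IsCompatibleBimodule A B U)
    (hT : IsLeftGorensteinRegular (TriangularRing A B U)) :
    IsLeftGorensteinRegular A ∧ IsLeftGorensteinRegular B := by
  obtain ⟨⟨n, hn⟩, m, hm⟩ := (isLeftGorensteinRegular_iff _).1 hT
  have hA : ∀ I : ModuleCat.{u} A, Injective I → HasProjectiveDimensionLE I n := fun I hI =>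
    have := hasProjectiveDimensionLE_obj (cornerA A B U) (cornerFunctor_shortExact _) (k := 0)
      (fun P hP => projective_iff_hasProjectiveDimensionLT_one.1 (cornerA_projective P hP)) n _
      (hn _ (functorA_injective (B := B) (U := U) I hI))
    hasProjectiveDimensionLT_of_iso (cornerAIso (B := B) (U := U) I) (n + 1)
  refine ⟨(isLeftGorensteinRegular_iff A).2 ⟨⟨n, hA⟩, m + n, fun F hF => ?_⟩,
    (isLeftGorensteinRegular_iff B).2 ⟨⟨n, fun J hJ => ?_⟩, m, fun F hF => ?_⟩⟩
  · obtain ⟨P, hP, ⟨h⟩⟩ := exists_retract_cornerA (B := B) (U := U) F hF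
    have := hasInjectiveDimensionLE_obj (cornerA A B U) (cornerFunctor_shortExact _)
      (hasInjectiveDimensionLE_cornerA_of_injective hU hA) m P (hm P hP)
    exact h.hasInjectiveDimensionLT (m + n + 1)
  · refine hasProjectiveDimensionLE_of_obj (functorB A B U) functorB_shortExact
      functorB_projective_iff n J ?_
    -- Over T, finite injective dimension, here `n + 1`, already forces projective dimension at most
    -- `n`.
    exact hasProjectiveDimensionLE_of_hasInjectiveDimensionLE hn _ _
      (hasInjectiveDimensionLE_functorB_of_injective hU hA J hJ)
  · have := hasInjectiveDimensionLE_obj (cornerB A B U) (cornerFunctor_shortExact _) (k := 0)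
      (fun I hI => injective_iff_hasInjectiveDimensionLT_one.1 (cornerB_injective I hI)) m _
      (hm _ ((functorB_projective_iff F).2 hF))
    exact hasInjectiveDimensionLT_of_iso (cornerBIso (A := A) (U := U) F) (m + 1)

theorem isLeftGorensteinRegular_of_components (hU : IsCompatibleBimodule A B U)
    (hA : IsLeftGorensteinRegular A) (hB : IsLeftGorensteinRegular B) :
    IsLeftGorensteinRegular (TriangularRing A B U) := by
  obtain ⟨⟨n₁, hn₁⟩, n₂, hn₂⟩ := (isLeftGorensteinRegular_iff _).1 hA
  obtain ⟨⟨n₃, hn₃⟩, n₄, hn₄⟩ := (isLeftGorensteinRegular_iff _).1 hB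
  let n := n₁ + n₂ + n₃ + n₄
  replace hn₁ : ∀ I : ModuleCat.{u} A, Injective I → HasProjectiveDimensionLE I n := fun I hI =>
    have := hn₁ I hI
    hasProjectiveDimensionLT_of_ge I (n₁ + 1) _ (by lia)
  replace hn₂ : ∀ P : ModuleCat.{u} A, Projective P → HasInjectiveDimensionLE P n := fun P hP =>
    have := hn₂ P hP
    hasInjectiveDimensionLT_of_ge P (n₂ + 1) _ (by lia)
  replace hn₃ : ∀ I : ModuleCat.{u} B, Injective I → HasProjectiveDimensionLE I n := fun I hI =>
    have := hn₃ I hI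
    hasProjectiveDimensionLT_of_ge I (n₃ + 1) _ (by lia)
  replace hn₄ : ∀ P : ModuleCat.{u} B, Projective P → HasInjectiveDimensionLE P n := fun P hP =>
    have := hn₄ P hP
    hasInjectiveDimensionLT_of_ge P (n₄ + 1) _ (by lia)
  have hcB := hasInjectiveDimensionLE_cornerB hU hn₃ hn₄
  have pdB := hasProjectiveDimensionLE_obj (functorB A B U) functorB_shortExact (k := 0)
    (fun P hP => projective_iff_hasProjectiveDimensionLT_one.1 ((functorB_projective_iff P).2 hP)) n
  have idA := hasInjectiveDimensionLE_obj (functorA A B U) functorA_shortExact (k := 0)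
    (fun I hI => injective_iff_hasInjectiveDimensionLT_one.1 (functorA_injective I hI)) n
  have idB := hasInjectiveDimensionLE_obj (functorB A B U) functorB_shortExact
    (hasInjectiveDimensionLE_functorB_of_injective hU hn₁) n
  -- (F, 0) is a retract of some (P₁, 0) = P / (0, P₂) with P projective. Here P₂ has finite
  -- injective dimension, hence projective dimension at most `n` by regularity of B.
  have pdA' (F : ModuleCat.{u} A) (hF : Projective F) :
      HasProjectiveDimensionLE ((functorA A B U).obj F) (n + 1) := by
    obtain ⟨P, hP, ⟨h⟩⟩ := exists_retract_cornerA (B := B) (U := U) F hF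
    have h₁ := (shortExact_ofSecond_toFirst P).hasProjectiveDimensionLT_X₃ (n + 1)
      (pdB _ (hasProjectiveDimensionLE_of_hasInjectiveDimensionLE hn₃ n _ (hcB P hP)))
      (hasProjectiveDimensionLT_of_ge P 1 _ (by lia))
    have h₂ : HasProjectiveDimensionLT ((functorA A B U).obj ((cornerA A B U).obj P))
      (n + 1 + 1) := h₁
    exact (h.map (functorA A B U)).hasProjectiveDimensionLT (n + 1 + 1)
  have pdA := hasProjectiveDimensionLE_obj (functorA A B U) functorA_shortExact pdA' n
  -- The summand `n` bounds the component and `n + 1` is the cost of viewing it as a T-module. The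
  -- costly end is (X₁, 0) for injective X and (0, P₂) for projective P.
  refine (isLeftGorensteinRegular_iff _).2 ⟨⟨n + (n + 1), fun X hX => ?_⟩,
    n + (n + 1), fun P hP => ?_⟩
  · refine (shortExact_ofSecond_toFirst X).hasProjectiveDimensionLT_X₂ (n + (n + 1) + 1) ?_
      (pdA _ (hasProjectiveDimensionLE_of_hasInjectiveDimensionLE hn₁ n _
        (hasInjectiveDimensionLE_cornerA_of_injective hU hn₁ X hX)))
    have := pdB _ (hn₃ _ (cornerB_injective X hX))
    exact hasProjectiveDimensionLT_of_ge _ (n + 0 + 1) _ (by lia)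
  · refine (shortExact_ofSecond_toFirst P).hasInjectiveDimensionLT_X₂ (n + (n + 1) + 1)
      (idB _ (hcB P hP)) ?_
    have := idA _ (hn₂ _ (cornerA_projective P hP))
    exact hasInjectiveDimensionLT_of_ge _ (n + 0 + 1) _ (by lia)

end TriangularRing

theorem mainTheorem11 (A B U : Type u) [Ring A] [Ring B] [AddCommGroup U] [Module B U]
    [Module Aᵐᵒᵖ U] [SMulCommClass B Aᵐᵒᵖ U] (hU : IsCompatibleBimodule A B U) :
    IsLeftGorensteinRegular (TriangularRing A B U) ↔
      IsLeftGorensteinRegular A ∧ IsLeftGorensteinRegular B :=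
  ⟨TriangularRing.isLeftGorensteinRegular_components hU,
    fun h => TriangularRing.isLeftGorensteinRegular_of_components hU h.1 h.2⟩
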